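/- For a finite field extension $M/k$, a Hopf–Galois structure on $M/k$ is a $k$-Hopf algebra $H$ with a $k$-linear action on $M$ making $M$ an $H$-module algebra, such that $j\colon M\otimes_k H\to \operatorname{End}_k(M)$, $j(x\otimes h)(y)=x\,(h\cdot y)$, is bijective; two such structures are identified if there is an isomorphism of $k$-Hopf algebras compatible with the actions. If $M/k$ is Galois with group $\Gamma$ and $N\subseteq\operatorname{Perm}(\Gamma)$ is a regular (simply transitive) subgroup normalized by the left translations $\lambda(\Gamma)$, let $M[N]^{\Gamma}$ be the $k$-Hopf algebra of elements of the group algebra $M[N]$ fixed by $\Gamma$, where $\Gamma$ acts on $M$ by automorphisms and $g\in\Gamma$ acts on $N$ by conjugation by $\lambda(g)$; it acts on $M$ by $\left(\sum_n c_n n\right)\cdot x=\sum_n c_n\, n^{-1}(1_\Gamma)(x)$. By the Greither–Pareigis correspondence, $N\mapsto M[N]^\Gamma$ is a bijection from the regular subgroups of $\operatorname{Perm}(\Gamma)$ normalized by $\lambda(\Gamma)$ to the Hopf–Galois structures on $M/k$. **Proposition.** Let $L/K$ be a finite Galois extension with Galois group $G=J\rtimes G'$ ($J$ a normal subgroup of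 $G$ and $G'$ a subgroup that is a complement of $J$), and let $E=L^{G'}$, $F=L^{J}$. Then $F/K$ is Galois with group $G/J$, $L/E$ is Galois with group $G'$, and there is a bijection between the Hopf–Galois structures of $F/K$ and those of $L/E$. Under the Greither–Pareigis correspondences for $F/K$ and $L/E$, it is given by sending a regular subgroup $\overline N\subseteq \operatorname{Perm}(G/J)$ normalized by $\lambda(G/J)$ to the regular subgroup $N_2\subseteq \operatorname{Perm}(G')$ normalized by $\lambda(G')$ obtained from it by transport along the isomorphism $G/J\cong G'$, $\overline\tau\leftrightarrow\tau$. Moreover, let $\overline H=F[\overline N]^{G/J}$ and $H_2=L[N_2]^{G'}$ be the Hopf algebras of corresponding structures. Then $H_2=E\otimes_K\overline H$: there is an isomorphism of $E$-Hopf algebras $e\colon E\otimes_K\overline H\to H_2$ that is compatible with the actions on $L=EF$, i.e. $e(a\otimes h)\cdot(yx)=a\,y\,(h\cdot x)$ for $a,y\in E$, $h\in\overline H$, $x\in F$, and such that $h\mapsto e(1\otimes h)$ is the restriction of the inclusion $F[\overline N]\subseteq L[N_2]$ given by $F\subseteq L$ and $\overline N\cong N_2$. Finally $\overline H=H_2^{J}$: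 the image of $h\mapsto e(1\otimes h)$ is the set of elements of $H_2$ that are fixed by $J$, where $\sigma\in G$ acts on $L[N_2]$ by $\sigma$ on the coefficients and by conjugation by $\lambda(\tau)$ on $N_2$, $\tau\in G'$ being the element with $\sigma J=\tau J$ (so $J$ acts trivially on $N_2$). -/

import Mathlib

open scoped TensorProduct

noncomputable section

universe u v

/-- A Hopf-Galois structure on a finite field extension `L / K`: a `K`-Hopf algebra `H` together
with a `K`-linear action `H → End_K(L)` making `L` an `H`-module algebra, such that
`j : L ⊗_K H → End_K(L)`, `j (x ⊗ h) (y) = x * (h · y)`, is bijective.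
(Since `h ↦ j (1 ⊗ h)` embeds `H` into `End_K(L)`, it is no restriction to take the carrier in
the universe of `L`.) -/
structure HopfGaloisStructure (K : Type u) (L : Type v) [Field K] [Field L] [Algebra K L] where
  /-- the underlying type of the Hopf algebra -/
  carrier : Type v
  [ring : Ring carrier]
  [hopf : HopfAlgebra K carrier]
  /-- the Hopf action, as an algebra homomorphism `H → End_K(L)` -/
  action : carrier →ₐ[K] Module.End K L
  /-- `h · 1 = ε(h)` -/
  action_one : ∀ h : carrier, action h 1 = algebraMap K L (Coalgebra.counit (R := K) h)
  /-- `h · (x y) = ∑ (h₁ · x) (h₂ · y)` -/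
  action_mul : ∀ (h : carrier) (x y : L),
    action h (x * y) =
      LinearMap.mul' K L
        (TensorProduct.map (action.toLinearMap.flip x) (action.toLinearMap.flip y)
          (Coalgebra.comul (R := K) h))
  /-- `j : L ⊗ H → End_K(L)` is bijective -/
  bijective : Function.Bijective
    (LinearMap.mul' K (Module.End K L) ∘ₗ
      TensorProduct.map (Algebra.lmul K L).toLinearMap action.toLinearMap)

attribute [instance] HopfGaloisStructure.ring HopfGaloisStructure.hopf

section Classes

variable {K : Type u} {L : Type v} [Field K] [Field L] [Algebra K L]

/-- Two Hopf-Galois structures are the same if there is an isomorphism of `K`-Hopf algebras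
compatible with the actions on `L`. (A bialgebra isomorphism of Hopf algebras respects
antipodes.) -/
instance hopfGaloisSetoid (K : Type u) (L : Type v) [Field K] [Field L] [Algebra K L] :
    Setoid (HopfGaloisStructure K L) where
  r S T := ∃ f : S.carrier ≃ₐc[K] T.carrier, ∀ h x, T.action (f h) x = S.action h x
  iseqv :=
    { refl := fun S => ⟨BialgEquiv.refl K S.carrier, fun _ _ => rfl⟩
      symm := by
        rintro S T ⟨f, hf⟩
        refine ⟨f.symm, fun h x => ?_⟩
        rw [← hf (f.symm h) x]
        congr 2
        exact f.apply_symm_apply h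
      trans := by
        rintro S T U ⟨f, hf⟩ ⟨g, hg⟩
        exact ⟨f.trans g, fun h x => (hg (f h) x).trans (hf h x)⟩ }

/-- The collection of Hopf-Galois structures of `L / K` (up to isomorphism). -/
def HopfGaloisClass (K : Type u) (L : Type v) [Field K] [Field L] [Algebra K L] :=
  Quotient (hopfGaloisSetoid K L)

/-- The class of a Hopf-Galois structure. -/
def HopfGaloisStructure.cls (S : HopfGaloisStructure K L) : HopfGaloisClass K L :=
  Quotient.mk _ S

end Classes

/-- A regular (i.e. simply transitive) subgroup of `Perm(Γ)` normalized by `λ(Γ)`, where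
`λ : Γ → Perm(Γ)` is the left regular representation. -/
structure RegularNormalizedSubgroup (Γ : Type v) [Group Γ] where
  /-- the subgroup -/
  toSubgroup : Subgroup (Equiv.Perm Γ)
  regular : ∀ x y : Γ, ∃! n : toSubgroup, (n : Equiv.Perm Γ) x = y
  normalized : ∀ (g : Γ), ∀ n ∈ toSubgroup,
    MulAction.toPermHom Γ Γ g * n * (MulAction.toPermHom Γ Γ g)⁻¹ ∈ toSubgroup

namespace RegularNormalizedSubgroup

variable {Γ : Type v} [Group Γ] (N : RegularNormalizedSubgroup Γ)

/-- Conjugation by `λ(g)` on `N`. -/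
def conj (g : Γ) : N.toSubgroup →* N.toSubgroup :=
  ((MulAut.conj (MulAction.toPermHom Γ Γ g)).toMonoidHom.comp N.toSubgroup.subtype).codRestrict
    N.toSubgroup fun n => N.normalized g n n.2

variable {M : Type v} [Field M]

/-- The semilinear action of a pair `(σ, g)` on `M[N]`: apply `σ` to the coefficients and
conjugation by `λ(g)` to the elements of `N`, i.e. `∑ cₙ n ↦ ∑ σ(cₙ) λ(g) n λ(g)⁻¹`. -/
def act (σ : M →+* M) (g : Γ) :
    MonoidAlgebra M N.toSubgroup →+* MonoidAlgebra M N.toSubgroup :=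
  (MonoidAlgebra.mapDomainRingHom M (N.conj g)).comp (MonoidAlgebra.mapRingHom N.toSubgroup σ)

variable {k : Type u} [Field k] [Algebra k M]

/-- The `k`-algebra `M[N]^Γ` of fixed points, where `Γ` is identified with `Gal(M/k)` by `φ` and
acts on `M` through `φ` and on `N` through conjugation by `λ(Γ)`. -/
def fixedPoints (φ : Γ ≃* (M ≃ₐ[k] M)) : Subalgebra k (MonoidAlgebra M N.toSubgroup) where
  carrier := {z | ∀ g : Γ, N.act (φ g : M →+* M) g z = z}
  mul_mem' ha hb g := by rw [map_mul, ha g, hb g]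
  add_mem' ha hb g := by rw [map_add, ha g, hb g]
  algebraMap_mem' r g := by
    simp [act, MonoidAlgebra.mapRingHom, MonoidAlgebra.mapDomainRingHom]

end RegularNormalizedSubgroup

section GreitherPareigis

variable {k : Type u} {M : Type v} [Field k] [Field M] [Algebra k M] {Γ : Type v} [Group Γ]

/-- An identification of a Hopf-Galois structure `S` of the Galois extension `M / k`
(`Γ ≅ Gal(M/k)` via `φ`) with the one attached to `N`: the `k`-Hopf algebra `M[N]^Γ`, with the
Hopf algebra structure inherited from the group algebra `M[N]`, acting on `M` by
`(∑ cₙ n) · x = ∑ cₙ n⁻¹(1)(x)`. -/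
structure GreitherPareigisIso (φ : Γ ≃* (M ≃ₐ[k] M)) (S : HopfGaloisStructure k M)
    (N : RegularNormalizedSubgroup Γ) where
  /-- the isomorphism of algebras `H ≅ M[N]^Γ` -/
  toAlgEquiv : S.carrier ≃ₐ[k] N.fixedPoints φ
  /-- The comultiplication of `H` is that of `M[N]`: the square formed by the two
  comultiplications and `H ⊗[k] H → M[N] ⊗[M] M[N]` commutes. -/
  comul_eq : ∀ h : S.carrier,
    Coalgebra.comul (R := M) (toAlgEquiv h : MonoidAlgebra M N.toSubgroup) =
      TensorProduct.mapOfCompatibleSMul M k k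
        (MonoidAlgebra M N.toSubgroup) (MonoidAlgebra M N.toSubgroup)
        (TensorProduct.map
          ((N.fixedPoints φ).val.comp toAlgEquiv.toAlgHom).toLinearMap
          ((N.fixedPoints φ).val.comp toAlgEquiv.toAlgHom).toLinearMap
          (Coalgebra.comul (R := k) h))
  /-- The counit of `H` is that of `M[N]`. -/
  counit_eq : ∀ h : S.carrier,
    Coalgebra.counit (R := M) (toAlgEquiv h : MonoidAlgebra M N.toSubgroup) =
      algebraMap k M (Coalgebra.counit (R := k) h)
  /-- The action of `H` is `(∑ cₙ n) · x = ∑ cₙ n⁻¹(1)(x)`. -/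
  action_eq : ∀ (h : S.carrier) (x : M),
    S.action h x =
      (toAlgEquiv h : MonoidAlgebra M N.toSubgroup).coeff.sum
        fun n c => c * φ ((n : Equiv.Perm Γ)⁻¹ 1) x

end GreitherPareigis

end

/-! The bijection is the composite of the Greither–Pareigis correspondence for `F/K`, transport
along `G/J ≅ G'`, and the inverse correspondence for `L/E`. So the work lies in proving the
correspondence and in comparing the two Hopf algebras.

From `N` to a structure: by Galois descent `M[N]^Γ` is a `k`-form of `M[N]`
(`isBaseChange_fixedPoints`), so the Hopf algebra structure descends. Evaluation at `1`, `n ↦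
φ(n⁻¹(1))`, identifies `M[N]` with `End_k(M)` by Dedekind independence, which makes `j` bijective.

From a structure to `N`: under `j : M ⊗ H ≅ End_k(M)` the automorphisms in the Galois group
correspond exactly to the group-like elements of `M ⊗ H`. The map `j` is not multiplicative for the
tensor product algebra, so the group-likes put a second group law on `Γ`. Its right translations
form `N`, and Galois equivariance shows that `λ(Γ)` normalizes it. A subgroup `N` belongs to `H`
exactly when `n ↦ j⁻¹(φ(n⁻¹(1)))` is multiplicative (`Compatible`), and this determines `N`.

Comultiplications need little computation: a tensor in `A ⊗ A` with `A ≅ End_k(M)` is determined by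
its values on pairs `x, y` (`eq_of_evalPair_eq`), so the action determines the comultiplication.

For the comparison, `H̄` is a `K`-form of `F[N̄]`, hence of `L[N₂]`; therefore `E ⊗ H̄` is an
`E`-form of `L[N₂]`. It consists of `G'`-fixed elements because `τ ∈ G'` acts on `F` as its class in
`G/J`, and by descent it is all of `L[N₂]^{G'} = H₂`. Finally `J` acts on coefficients only and `L^J
= F`, so the `J`-fixed elements of `H₂` have coefficients in `F` and are `G/J`-fixed in `F[N̄]`,
that is, they lie in `H̄`. -/

noncomputable section

/-! ### Tensor products of forms over an extension field. -/

section TensorOver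

variable {k M X Y V W : Type*} [Field k] [Field M] [Algebra k M]
  [AddCommGroup X] [Module k X] [AddCommGroup Y] [Module k Y]
  [AddCommGroup V] [Module k V] [Module M V] [IsScalarTower k M V]
  [AddCommGroup W] [Module k W] [Module M W] [IsScalarTower k M W]

variable (M) in
/-- The map `X ⊗[k] Y → V ⊗[M] W` induced by `k`-linear maps `X → V` and `Y → W`. -/
def tensorOver (f : X →ₗ[k] V) (g : Y →ₗ[k] W) : X ⊗[k] Y →ₗ[k] V ⊗[M] W :=
  TensorProduct.mapOfCompatibleSMul M k k V W ∘ₗ TensorProduct.map f g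

@[simp]
theorem tensorOver_tmul (f : X →ₗ[k] V) (g : Y →ₗ[k] W) (x : X) (y : Y) :
    tensorOver M f g (x ⊗ₜ[k] y) = f x ⊗ₜ[M] g y := rfl

theorem IsBaseChange.tensorOver {f : X →ₗ[k] V} {g : Y →ₗ[k] W} (hf : IsBaseChange M f)
    (hg : IsBaseChange M g) : IsBaseChange M (tensorOver M f g) :=
  IsBaseChange.of_equiv
    ((TensorProduct.AlgebraTensorModule.distribBaseChange k M X Y).trans
      (TensorProduct.congr hf.equiv hg.equiv)) fun z => by
    induction z with
    | zero => simp
    | add a b ha hb => rw [TensorProduct.tmul_add, map_add, map_add, ha, hb]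
    | tmul x y =>
      rw [LinearEquiv.trans_apply, TensorProduct.AlgebraTensorModule.distribBaseChange_tmul]
      simp [IsBaseChange.equiv_tmul]

/-- A field extension is faithfully flat, so `x ↦ 1 ⊗ x` is injective. Identities over `k` can
therefore be checked after extension to `M`. -/
theorem IsBaseChange.injective_of_field {f : X →ₗ[k] V} (hf : IsBaseChange M f) :
    Function.Injective f := fun x y hxy =>
  Module.FaithfullyFlat.tensorProduct_mk_injective (A := k) (B := M) X <| by
    have h := congrArg hf.equiv.symm hxy
    rwa [hf.equiv_symm_apply, hf.equiv_symm_apply] at h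

end TensorOver

/-! ### Galois descent for semilinear actions. -/

section GaloisDescent

variable {k M Γ : Type*} [Field k] [Field M] [Algebra k M] [FiniteDimensional k M] [IsGalois k M]
  [Group Γ] (φ : Γ ≃* (M ≃ₐ[k] M))

include φ in
theorem finite_of_mulEquiv_gal : Finite Γ := Finite.of_equiv _ φ.symm.toEquiv

include φ in
theorem card_eq_finrank_of_mulEquiv_gal : Nat.card Γ = Module.finrank k M := by
  rw [Nat.card_congr φ.toEquiv, IsGalois.card_aut_eq_finrank]

/-- Dedekind: the elements of the Galois group are linearly independent over `M`. -/
theorem linearIndependent_gal :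
    LinearIndependent M fun g : Γ => ((φ g : M ≃ₐ[k] M).toLinearMap : M →ₗ[k] M) :=
  (linearIndependent_algHom_toLinearMap k M M).comp (fun g => (φ g : M →ₐ[k] M)) fun _ _ h =>
    φ.injective <| AlgEquiv.ext fun x => DFunLike.congr_fun h x

theorem gal_trace_mem [Fintype Γ] (m : M) : ∑ g : Γ, φ g m ∈ (algebraMap k M).range :=
  ⟨Algebra.trace k M m, by
    rw [trace_eq_sum_automorphisms]
    exact (Equiv.sum_comp φ.toEquiv fun σ : M ≃ₐ[k] M => σ m).symm⟩

theorem exists_gal_trace_eq_one [Fintype Γ] : ∃ t : M, ∑ g : Γ, φ g t = 1 := by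
  obtain ⟨t, ht⟩ := Algebra.trace_surjective k M 1
  refine ⟨t, ?_⟩
  rw [← map_one (algebraMap k M), ← ht, trace_eq_sum_automorphisms]
  exact Equiv.sum_comp φ.toEquiv fun σ : M ≃ₐ[k] M => σ t

/-- Galois coordinates: `∑ cᵢ g(bᵢ) = δ_{g,1}`. -/
theorem exists_galois_coordinates [DecidableEq Γ] :
    ∃ c : M →₀ M, ∀ g : Γ, (c.sum fun b a => a * φ g b) = if g = 1 then 1 else 0 := by
  classical
  have := finite_of_mulEquiv_gal φ
  have := Fintype.ofFinite Γ
  let w : M → Γ → M := fun b g => φ g b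
  -- A nonzero functional killing all vectors `(φ g b)_g` would be a linear relation among the
  -- automorphisms, against Dedekind.
  have htop : Submodule.span M (Set.range w) = ⊤ := by
    by_contra hne
    obtain ⟨f, hf0, hf⟩ := Submodule.exists_le_ker_of_lt_top _ (lt_top_iff_ne_top.mpr hne)
    apply hf0
    have hz := Fintype.linearIndependent_iff.mp (linearIndependent_gal φ)
      (fun g => f (Pi.single g 1)) (by
        ext b
        have hb : f (w b) = 0 := hf (Submodule.subset_span ⟨b, rfl⟩)
        rw [pi_eq_sum_univ' (w b), map_sum] at hb
        simpa [w, mul_comm, Pi.single_apply, eq_comm] using hb)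
    ext g
    simpa using hz g
  have hmem : (Pi.single 1 1 : Γ → M) ∈ Submodule.span M (Set.range w) := htop ▸ trivial
  obtain ⟨c, hc⟩ := Finsupp.mem_span_range_iff_exists_finsupp.mp hmem
  refine ⟨c, fun g => ?_⟩
  have := congrFun hc g
  simpa [Finsupp.sum, w, Pi.single_apply] using this

/-- Every vector is a combination of traces of its multiples: exchanging the two sums leaves only
the term `g = 1`. -/
theorem galois_coordinates_reconstruct [DecidableEq Γ] [Fintype Γ] {c : M →₀ M}
    (hc : ∀ g : Γ, (c.sum fun b a => a * φ g b) = if g = 1 then 1 else 0)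
    {U : Type*} [AddCommGroup U] [Module M U] (τ : Γ → U →+ U)
    (hτ : ∀ g (m : M) u, τ g (m • u) = φ g m • τ g u) (h1 : ∀ u, τ 1 u = u) (u : U) :
    (c.sum fun b a => a • ∑ g : Γ, τ g (b • u)) = u := by
  simp only [Finsupp.sum, hτ, Finset.smul_sum, smul_smul]
  rw [Finset.sum_comm]
  simp only [← Finset.sum_smul]
  have : ∀ g, ∑ b ∈ c.support, c b * φ g b = if g = 1 then 1 else 0 := hc
  simp [this, h1]

theorem map_sum_orbit [Fintype Γ] {U : Type*} [AddCommGroup U] (τ : Γ → U →+ U)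
    (hτ : ∀ g h u, τ (g * h) u = τ g (τ h u)) (u : U) (h : Γ) :
    τ h (∑ g : Γ, τ g u) = ∑ g : Γ, τ g u := by
  rw [map_sum]
  simp only [← hτ]
  exact Equiv.sum_comp (Equiv.mulLeft h) fun g => τ g u

variable {X V : Type*} [AddCommGroup X] [Module k X]
  [AddCommGroup V] [Module k V] [Module M V] [IsScalarTower k M V]

/-- A vector fixed by the semilinear Galois action lies in the `k`-form. -/
theorem IsBaseChange.mem_range_of_fixed {f : X →ₗ[k] V} (hf : IsBaseChange M f)
    (ρ : Γ → V →+ V) (hρ : ∀ g (m : M) v, ρ g (m • v) = φ g m • ρ g v)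
    (hρf : ∀ g x, ρ g (f x) = f x) {v : V} (hv : ∀ g, ρ g v = v) : v ∈ LinearMap.range f := by
  have := finite_of_mulEquiv_gal φ
  have := Fintype.ofFinite Γ
  -- With `t` of trace `1`, a fixed `v` equals `∑ g(t v)`, and on pure tensors such a sum is `Tr(t
  -- m) • f x`, with the trace in `k`.
  obtain ⟨t, ht⟩ := exists_gal_trace_eq_one φ
  have key : ∀ z : M ⊗[k] X, ∑ g : Γ, ρ g (t • hf.equiv z) ∈ LinearMap.range f := by
    intro z
    induction z with
    | zero => simp
    | add a b ha hb =>
      simp only [map_add, smul_add, Finset.sum_add_distrib]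
      exact add_mem ha hb
    | tmul m x =>
      simp only [hf.equiv_tmul, smul_smul, hρ, hρf, ← Finset.sum_smul]
      obtain ⟨c, hc⟩ := gal_trace_mem φ (t * m)
      rw [← hc, algebraMap_smul]
      exact ⟨c • x, map_smul _ _ _⟩
  have h := key (hf.equiv.symm v)
  simpa [hρ, hv, ← Finset.sum_smul, ht] using h

/-- Galois descent: the fixed vectors of a semilinear action form a `k`-form. -/
theorem isBaseChange_of_range_eq_fixed {f : X →ₗ[k] V} (hinj : Function.Injective f)
    (ρ : Γ → V →+ V) (hρ : ∀ g (m : M) v, ρ g (m • v) = φ g m • ρ g v)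
    (hmul : ∀ g h v, ρ (g * h) v = ρ g (ρ h v)) (hone : ∀ v, ρ 1 v = v)
    (hfix : ∀ v, v ∈ LinearMap.range f ↔ ∀ g, ρ g v = v) : IsBaseChange M f := by
  classical
  have := finite_of_mulEquiv_gal φ
  have := Fintype.ofFinite Γ
  obtain ⟨c, hc⟩ := exists_galois_coordinates φ
  let F : M ⊗[k] X →ₗ[M] V := LinearMap.liftBaseChange M f
  have hF : ∀ m x, F (m ⊗ₜ[k] x) = m • f x := fun m x => by simp [F]
  let τ : Γ → M ⊗[k] X →+ M ⊗[k] X := fun g =>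
    (TensorProduct.map (φ g).toLinearMap (LinearMap.id : X →ₗ[k] X)).toAddMonoidHom
  have hτt : ∀ g m (x : X), τ g (m ⊗ₜ[k] x) = φ g m ⊗ₜ[k] x := fun g m x => rfl
  have hτs : ∀ g (m : M) u, τ g (m • u) = φ g m • τ g u := by
    intro g m u
    induction u with
    | zero => simp
    | add a b ha hb => rw [smul_add, map_add, map_add, ha, hb, smul_add]
    | tmul a x => simp [TensorProduct.smul_tmul', hτt]
  have hτ1 : ∀ u, τ 1 u = u := by
    intro u
    induction u with
    | zero => simp
    | add a b ha hb => rw [map_add, ha, hb]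
    | tmul a x => simp [hτt]
  have hτm : ∀ g h u, τ (g * h) u = τ g (τ h u) := by
    intro g h u
    induction u with
    | zero => simp
    | add a b ha hb => rw [map_add, ha, hb, map_add, map_add]
    | tmul a x => simp [hτt]
  have hFτ : ∀ g u, F (τ g u) = ρ g (F u) := by
    intro g u
    induction u with
    | zero => simp
    | add a b ha hb => rw [map_add, map_add, ha, hb, map_add, map_add]
    | tmul a x => rw [hτt, hF, hF, hρ, (hfix (f x)).mp ⟨x, rfl⟩ g]
  -- Each trace `∑ τ g (b • z)` is fixed, hence of the form `1 ⊗ x`; as `F` kills it and `f` is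
  -- injective, it vanishes. Reconstruction then gives `z = 0`.
  have Finj : Function.Injective F := by
    rw [injective_iff_map_eq_zero]
    intro z hz
    have hb : ∀ b : M, ∑ g : Γ, τ g (b • z) = 0 := by
      intro b
      obtain ⟨x, hx⟩ := (TensorProduct.isBaseChange k X M).mem_range_of_fixed φ τ hτs
        (fun g x => by simp [hτt]) (fun h => map_sum_orbit τ hτm (b • z) h)
      have hx' : (1 : M) ⊗ₜ[k] x = ∑ g : Γ, τ g (b • z) := hx
      have : F ((1 : M) ⊗ₜ[k] x) = 0 := by simp [hx', hFτ, hz]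
      rw [hF, one_smul] at this
      rw [← hx', (map_eq_zero_iff f hinj).mp this, TensorProduct.tmul_zero]
    rw [← galois_coordinates_reconstruct φ hc τ hτs hτ1 z]
    simp [hb]
  have Fsurj : Function.Surjective F := by
    intro v
    rw [← galois_coordinates_reconstruct φ hc ρ hρ hone v]
    refine (LinearMap.mem_range (f := F)).mp (sum_mem fun b _ => Submodule.smul_mem _ _ ?_)
    obtain ⟨x, hx⟩ := (hfix _).mpr fun h => map_sum_orbit ρ hmul (b • v) h
    exact ⟨1 ⊗ₜ[k] x, by rw [hF, one_smul, hx]⟩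
  exact IsBaseChange.of_equiv (LinearEquiv.ofBijective F ⟨Finj, Fsurj⟩) fun x =>
    (hF 1 x).trans (one_smul _ _)

end GaloisDescent

/-! ### Descent of Hopf algebra structures. -/

theorem tensorOver_mul {k M H B : Type*} [Field k] [Field M] [Algebra k M] [Ring H] [Algebra k H]
    [Ring B] [Algebra k B] [Algebra M B] [IsScalarTower k M B] (ι : H →ₐ[k] B) (x y : H ⊗[k] H) :
    tensorOver M ι.toLinearMap ι.toLinearMap (x * y) =
      tensorOver M ι.toLinearMap ι.toLinearMap x * tensorOver M ι.toLinearMap ι.toLinearMap y := by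
  induction x with
  | zero => simp
  | add a b ha hb => rw [add_mul, map_add, map_add, ha, hb, add_mul]
  | tmul a b =>
    induction y with
    | zero => simp
    | add a b ha hb => rw [mul_add, map_add, map_add, ha, hb, mul_add]
    | tmul c d => simp

section HopfDescent

open Coalgebra HopfAlgebra

variable {k M H B : Type*} [Field k] [Field M] [Algebra k M] [Ring H] [Algebra k H]
  [Ring B] [Algebra k B] [HopfAlgebra M B] [IsScalarTower k M B]

/-- The `k`-linear lift of a `k`-linear map whose values lie in the range of an injective map. -/
def liftOfRange {X Y Z : Type*} [AddCommGroup X] [Module k X] [AddCommGroup Y] [Module k Y]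
    [AddCommGroup Z] [Module k Z] (i : Y →ₗ[k] Z) (hi : Function.Injective i) (f : X →ₗ[k] Z)
    (hf : ∀ x, f x ∈ LinearMap.range i) : X →ₗ[k] Y :=
  (LinearEquiv.ofInjective i hi).symm.toLinearMap ∘ₗ f.codRestrict _ hf

theorem liftOfRange_spec {X Y Z : Type*} [AddCommGroup X] [Module k X] [AddCommGroup Y]
    [Module k Y] [AddCommGroup Z] [Module k Z] (i : Y →ₗ[k] Z) (hi : Function.Injective i)
    (f : X →ₗ[k] Z) (hf : ∀ x, f x ∈ LinearMap.range i) (x : X) :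
    i (liftOfRange i hi f hf x) = f x := by
  have := LinearEquiv.apply_symm_apply (LinearEquiv.ofInjective i hi) (f.codRestrict _ hf x)
  exact congrArg Subtype.val this

/-- A `k`-form of an `M`-Hopf algebra that is stable under the structure maps is a `k`-Hopf
algebra. -/
@[reducible]
def HopfAlgebra.ofIsBaseChange (ι : H →ₐ[k] B) (hι : IsBaseChange M ι.toLinearMap)
    (hΔ : ∀ h, comul (R := M) (ι h) ∈
      LinearMap.range (tensorOver M ι.toLinearMap ι.toLinearMap))
    (hε : ∀ h, counit (R := M) (ι h) ∈ LinearMap.range (Algebra.linearMap k M))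
    (hS : ∀ h, antipode M (ι h) ∈ LinearMap.range ι.toLinearMap) : HopfAlgebra k H :=
  let T2 := tensorOver M ι.toLinearMap ι.toLinearMap
  have hT2 : Function.Injective T2 := (hι.tensorOver hι).injective_of_field
  -- Each Hopf axiom for `H` is checked after applying the injective map `ι`, `T2`, `T3` or `k → M`,
  -- where it becomes the same axiom for `B`.
  let T3 := tensorOver M ι.toLinearMap T2
  have hT3 : Function.Injective T3 := (hι.tensorOver (hι.tensorOver hι)).injective_of_field
  have hι' : Function.Injective ι := hι.injective_of_field
  let Δ : H →ₗ[k] H ⊗[k] H := liftOfRange T2 hT2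
    (((comul (R := M) (A := B)).restrictScalars k) ∘ₗ ι.toLinearMap) hΔ
  let ε : H →ₗ[k] k := liftOfRange (Algebra.linearMap k M) (algebraMap k M).injective
    (((counit (R := M) (A := B)).restrictScalars k) ∘ₗ ι.toLinearMap) hε
  let S : H →ₗ[k] H := liftOfRange ι.toLinearMap hι'
    (((antipode M (A := B)).restrictScalars k) ∘ₗ ι.toLinearMap) hS
  have sΔ : ∀ h, T2 (Δ h) = comul (R := M) (ι h) := liftOfRange_spec _ _ _ _
  have sε : ∀ h, algebraMap k M (ε h) = counit (R := M) (ι h) :=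
    liftOfRange_spec (Algebra.linearMap k M) _ _ hε
  have sS : ∀ h, ι (S h) = antipode M (ι h) :=
    liftOfRange_spec ι.toLinearMap hι' _ hS
  have hl : ∀ z, T3 (Δ.lTensor H z) = (comul (R := M) (A := B)).lTensor B (T2 z) := by
    intro z
    induction z with
    | zero => simp
    | add a b ha hb => simp only [map_add, ha, hb]
    | tmul x y => simp [T3, sΔ, T2]
  have ha : ∀ (w : H ⊗[k] H) (y : H), T3 (TensorProduct.assoc k H H H (w ⊗ₜ[k] y)) =
      TensorProduct.assoc M B B B (T2 w ⊗ₜ[M] ι y) := by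
    intro w y
    induction w with
    | zero => simp
    | add a b ha hb => simp only [TensorProduct.add_tmul, map_add, ha, hb]
    | tmul x z => simp [T3, T2]
  have hr : ∀ z, T3 (TensorProduct.assoc k H H H (Δ.rTensor H z)) =
      TensorProduct.assoc M B B B ((comul (R := M) (A := B)).rTensor B (T2 z)) := by
    intro z
    induction z with
    | zero => simp
    | add a b ha hb => simp only [map_add, ha, hb]
    | tmul x y => rw [LinearMap.rTensor_tmul, ha, sΔ]; simp [T2]
  have hεr : ∀ z, ι (TensorProduct.lid k H (ε.rTensor H z)) =
      TensorProduct.lid M B ((counit (R := M) (A := B)).rTensor B (T2 z)) := by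
    intro z
    induction z with
    | zero => simp
    | add a b ha hb => simp only [map_add, ha, hb]
    | tmul x y => simp [T2, ← sε]
  have hεl : ∀ z, ι (TensorProduct.rid k H (ε.lTensor H z)) =
      TensorProduct.rid M B ((counit (R := M) (A := B)).lTensor B (T2 z)) := by
    intro z
    induction z with
    | zero => simp
    | add a b ha hb => simp only [map_add, ha, hb]
    | tmul x y => simp [T2, ← sε]
  have hSr : ∀ z, ι (LinearMap.mul' k H (S.rTensor H z)) =
      LinearMap.mul' M B ((antipode M (A := B)).rTensor B (T2 z)) := by
    intro z
    induction z with
    | zero => simp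
    | add a b ha hb => simp only [map_add, ha, hb]
    | tmul x y => simp [T2, ← sS]
  have hSl : ∀ z, ι (LinearMap.mul' k H (S.lTensor H z)) =
      LinearMap.mul' M B ((antipode M (A := B)).lTensor B (T2 z)) := by
    intro z
    induction z with
    | zero => simp
    | add a b ha hb => simp only [map_add, ha, hb]
    | tmul x y => simp [T2, ← sS]
  { ‹Algebra k H› with
    comul := Δ
    counit := ε
    antipode := S
    coassoc := by
      ext h
      apply hT3
      simp only [LinearMap.comp_apply, LinearEquiv.coe_coe, hr, hl, sΔ]
      exact Coalgebra.coassoc_apply _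
    rTensor_counit_comp_comul := by
      ext h
      apply (TensorProduct.lid k H).injective
      apply hι'
      simp only [LinearMap.comp_apply, hεr, sΔ, Coalgebra.rTensor_counit_comul]
      simp
    lTensor_counit_comp_comul := by
      ext h
      apply (TensorProduct.rid k H).injective
      apply hι'
      simp only [LinearMap.comp_apply, hεl, sΔ, Coalgebra.lTensor_counit_comul]
      simp
    counit_one := (algebraMap k M).injective ((sε 1).trans
      ((by simp : counit (R := M) (ι 1) = 1).trans (map_one (algebraMap k M)).symm))
    mul_compr₂_counit := by
      ext a b
      apply (algebraMap k M).injective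
      refine (sε (a * b)).trans (Eq.trans ?_ (map_mul (algebraMap k M) (ε a) (ε b)).symm)
      rw [map_mul, Bialgebra.counit_mul, ← sε, ← sε]
    comul_one := hT2 ((sΔ 1).trans
      (by simp [T2, Algebra.TensorProduct.one_def] : comul (R := M) (ι 1) = T2 (1 ⊗ₜ[k] 1)))
    mul_compr₂_comul := by
      ext a b
      apply hT2
      refine (sΔ (a * b)).trans (Eq.trans ?_ (tensorOver_mul ι (Δ a) (Δ b)).symm)
      rw [map_mul, Bialgebra.comul_mul, ← sΔ, ← sΔ]
    mul_antipode_rTensor_comul := by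
      ext h
      apply hι'
      refine (hSr (Δ h)).trans ?_
      rw [sΔ, HopfAlgebra.mul_antipode_rTensor_comul_apply, ← sε,
        ← IsScalarTower.algebraMap_apply]
      exact (ι.commutes (ε h)).symm
    mul_antipode_lTensor_comul := by
      ext h
      apply hι'
      refine (hSl (Δ h)).trans ?_
      rw [sΔ, HopfAlgebra.mul_antipode_lTensor_comul_apply, ← sε,
        ← IsScalarTower.algebraMap_apply]
      exact (ι.commutes (ε h)).symm }

theorem HopfAlgebra.tensorOver_comul_ofIsBaseChange (ι : H →ₐ[k] B)
    (hι : IsBaseChange M ι.toLinearMap) (hΔ) (hε) (hS) (h : H) :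
    tensorOver M ι.toLinearMap ι.toLinearMap
      ((HopfAlgebra.ofIsBaseChange ι hι hΔ hε hS).comul h) = comul (R := M) (ι h) :=
  liftOfRange_spec _ _ _ _ h

theorem HopfAlgebra.algebraMap_counit_ofIsBaseChange (ι : H →ₐ[k] B)
    (hι : IsBaseChange M ι.toLinearMap) (hΔ) (hε) (hS) (h : H) :
    algebraMap k M ((HopfAlgebra.ofIsBaseChange ι hι hΔ hε hS).counit h) =
      counit (R := M) (ι h) :=
  liftOfRange_spec (Algebra.linearMap k M) _ _ hε h

end HopfDescent

/-! ### The semilinear action on `M[N]` and its evaluation in `End_k(M)`. -/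

namespace RegularNormalizedSubgroup

variable {Γ : Type v} [Group Γ] (N : RegularNormalizedSubgroup Γ)

theorem ext' {N N' : RegularNormalizedSubgroup Γ} (h : N.toSubgroup = N'.toSubgroup) : N = N' := by
  cases N; cases N'; cases h; rfl

@[simp]
theorem conj_apply_apply (g : Γ) (n : N.toSubgroup) (x : Γ) :
    (N.conj g n : Equiv.Perm Γ) x = g * (n : Equiv.Perm Γ) (g⁻¹ * x) := by
  change (MulAction.toPermHom Γ Γ g * (n : Equiv.Perm Γ) * (MulAction.toPermHom Γ Γ g)⁻¹) x = _
  rw [← map_inv]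
  rfl

@[simp]
theorem conj_inv_apply (g : Γ) (n : N.toSubgroup) (x : Γ) :
    (N.conj g n : Equiv.Perm Γ)⁻¹ x = g * (n : Equiv.Perm Γ)⁻¹ (g⁻¹ * x) := by
  have h := N.conj_apply_apply g n⁻¹ x
  rwa [map_inv] at h

theorem conj_mul (g h : Γ) (n : N.toSubgroup) : N.conj (g * h) n = N.conj g (N.conj h n) := by
  ext x
  simp [mul_assoc]

@[simp]
theorem conj_one (n : N.toSubgroup) : N.conj 1 n = n := by
  ext x
  simp

theorem conj_injective (g : Γ) : Function.Injective (N.conj g) := fun a b h => by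
  rw [← N.conj_one a, ← N.conj_one b, ← inv_mul_cancel g, conj_mul, conj_mul, h]

/-- Evaluation at the identity, `n ↦ n⁻¹(1)`. -/
def pointEquiv : N.toSubgroup ≃ Γ :=
  Equiv.ofBijective (fun n => (n : Equiv.Perm Γ)⁻¹ 1) ⟨fun a b h => by
      obtain ⟨_, -, hu⟩ := N.regular 1 ((a : Equiv.Perm Γ)⁻¹ 1)
      exact inv_injective ((hu a⁻¹ rfl).trans (hu b⁻¹ h.symm).symm),
    fun y => by
      obtain ⟨n, hn, -⟩ := N.regular 1 y
      exact ⟨n⁻¹, by simpa using hn⟩⟩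

theorem pointEquiv_apply (n : N.toSubgroup) : N.pointEquiv n = (n : Equiv.Perm Γ)⁻¹ 1 := rfl

variable {M : Type v} [Field M]

@[simp]
theorem act_single (σ : M →+* M) (g : Γ) (n : N.toSubgroup) (c : M) :
    N.act σ g (MonoidAlgebra.single n c) = MonoidAlgebra.single (N.conj g n) (σ c) := by
  simp [act]

theorem act_smul (σ : M →+* M) (g : Γ) (m : M) (z : MonoidAlgebra M N.toSubgroup) :
    N.act σ g (m • z) = σ m • N.act σ g z := by
  induction z using MonoidAlgebra.induction_linear with
  | zero => simp
  | add x y hx hy => simp [hx, hy]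
  | single n c => simp

theorem act_act (σ τ : M →+* M) (g h : Γ) (z : MonoidAlgebra M N.toSubgroup) :
    N.act σ g (N.act τ h z) = N.act (σ.comp τ) (g * h) z := by
  induction z using MonoidAlgebra.induction_linear with
  | zero => simp
  | add x y hx hy => simp [hx, hy]
  | single n c => simp [conj_mul]

theorem act_id_one (z : MonoidAlgebra M N.toSubgroup) : N.act (RingHom.id M) 1 z = z := by
  induction z using MonoidAlgebra.induction_linear with
  | zero => simp
  | add x y hx hy => simp [hx, hy]
  | single n c => simp

theorem coeff_act (σ : M →+* M) (g : Γ) (z : MonoidAlgebra M N.toSubgroup) (n : N.toSubgroup) :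
    (N.act σ g z).coeff (N.conj g n) = σ (z.coeff n) := by
  classical
  induction z using MonoidAlgebra.induction_linear with
  | zero => simp
  | add x y hx hy => simp [hx, hy]
  | single m c =>
    simp only [act_single, MonoidAlgebra.coeff_single, Finsupp.single_apply,
      (N.conj_injective g).eq_iff]
    split_ifs <;> simp

/-- The semilinear action on `M[N]` as a semilinear map. -/
def actₛₗ (σ : M →+* M) (g : Γ) :
    MonoidAlgebra M N.toSubgroup →ₛₗ[σ] MonoidAlgebra M N.toSubgroup where
  toFun := N.act σ g
  map_add' := map_add _
  map_smul' := N.act_smul σ g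

@[simp]
theorem actₛₗ_apply (σ : M →+* M) (g : Γ) (z : MonoidAlgebra M N.toSubgroup) :
    N.actₛₗ σ g z = N.act σ g z := rfl

theorem comul_act (σ : M →+* M) (g : Γ) (z : MonoidAlgebra M N.toSubgroup) :
    Coalgebra.comul (R := M) (N.act σ g z) =
      TensorProduct.map (N.actₛₗ σ g) (N.actₛₗ σ g) (Coalgebra.comul (R := M) z) := by
  induction z using MonoidAlgebra.induction_linear with
  | zero => simp
  | add x y hx hy => simp [hx, hy]
  | single n c => simp

theorem counit_act (σ : M →+* M) (g : Γ) (z : MonoidAlgebra M N.toSubgroup) :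
    Coalgebra.counit (R := M) (N.act σ g z) = σ (Coalgebra.counit (R := M) z) := by
  induction z using MonoidAlgebra.induction_linear with
  | zero => simp
  | add x y hx hy => simp [hx, hy]
  | single n c => simp

theorem antipode_act (σ : M →+* M) (g : Γ) (z : MonoidAlgebra M N.toSubgroup) :
    HopfAlgebra.antipode M (N.act σ g z) = N.act σ g (HopfAlgebra.antipode M z) := by
  induction z using MonoidAlgebra.induction_linear with
  | zero => simp
  | add x y hx hy => simp [hx, hy]
  | single n c => simp

variable {k : Type u} [Field k] [Algebra k M] (φ : Γ ≃* (M ≃ₐ[k] M))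

/-- The map `M[N] → End_k(M)`, `∑ cₙ n ↦ (x ↦ ∑ cₙ n⁻¹(g)(x))`. -/
def evalAt (g : Γ) : MonoidAlgebra M N.toSubgroup →ₗ[M] Module.End k M :=
  Finsupp.linearCombination M
      (fun n : N.toSubgroup => (φ ((n : Equiv.Perm Γ)⁻¹ g)).toLinearMap) ∘ₗ
    (MonoidAlgebra.coeffLinearEquiv M).toLinearMap

@[simp]
theorem evalAt_single (g : Γ) (n : N.toSubgroup) (c : M) :
    N.evalAt φ g (MonoidAlgebra.single n c) =
      c • (φ ((n : Equiv.Perm Γ)⁻¹ g)).toLinearMap := by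
  simp [evalAt, MonoidAlgebra.coeffLinearEquiv]

theorem evalAt_one_apply (z : MonoidAlgebra M N.toSubgroup) (x : M) :
    N.evalAt φ 1 z x = z.coeff.sum fun n c => c * φ ((n : Equiv.Perm Γ)⁻¹ 1) x := by
  change (Finsupp.linearCombination M (fun n : N.toSubgroup =>
    (φ ((n : Equiv.Perm Γ)⁻¹ 1)).toLinearMap) z.coeff : Module.End k M) x = _
  simp [Finsupp.linearCombination_apply, Finsupp.sum]

theorem apply_evalAt (g h : Γ) (z : MonoidAlgebra M N.toSubgroup) (x : M) :
    φ g (N.evalAt φ h z x) = N.evalAt φ (g * h) (N.act (φ g : M →+* M) g z) x := by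
  induction z using MonoidAlgebra.induction_linear with
  | zero => simp
  | add x y hx hy => simp [hx, hy]
  | single n c => simp

theorem evalAt_single_mul (h : Γ) (n : N.toSubgroup) (c : M)
    (z : MonoidAlgebra M N.toSubgroup) :
    N.evalAt φ h (MonoidAlgebra.single n c * z) =
      c • N.evalAt φ ((n : Equiv.Perm Γ)⁻¹ h) z := by
  induction z using MonoidAlgebra.induction_linear with
  | zero => simp
  | add x y hx hy => simp [mul_add, hx, hy]
  | single m d => simp [MonoidAlgebra.single_mul_single, smul_smul]

/-- On all of `M[N]` the evaluation is only linear. Multiplying by `n` on the left moves the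
evaluation point to `n⁻¹(1)`, and for fixed `w` the value there is `φ(n⁻¹(1))` composed with the
value at `1`. This is why evaluation at arbitrary points was introduced. -/
theorem evalAt_mul_of_fixed (z w : MonoidAlgebra M N.toSubgroup)
    (hw : ∀ g : Γ, N.act (φ g : M →+* M) g w = w) :
    N.evalAt φ 1 (z * w) = N.evalAt φ 1 z * N.evalAt φ 1 w := by
  induction z using MonoidAlgebra.induction_linear with
  | zero => simp
  | add x y hx hy => simp [add_mul, hx, hy]
  | single n c =>
    ext x
    rw [evalAt_single_mul, evalAt_single, Module.End.mul_apply, LinearMap.smul_apply,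
      LinearMap.smul_apply, AlgEquiv.toLinearMap_apply, apply_evalAt, hw, mul_one]

section Galois

variable [FiniteDimensional k M] [IsGalois k M]

/-- The basis of the `M`-space `End_k(M)` given by the Galois group. -/
def galBasis (φ : Γ ≃* (M ≃ₐ[k] M)) : Module.Basis Γ M (Module.End k M) :=
  have := finite_of_mulEquiv_gal φ
  letI := Fintype.ofFinite Γ
  haveI : Nonempty Γ := ⟨1⟩
  basisOfLinearIndependentOfCardEqFinrank (linearIndependent_gal φ) (by
    rw [← Nat.card_eq_fintype_card, card_eq_finrank_of_mulEquiv_gal φ]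
    exact (Module.finrank_linearMap_self k M M).symm)

@[simp]
theorem galBasis_apply (g : Γ) : galBasis φ g = (φ g).toLinearMap := by
  simp [galBasis]

/-- `M[N] ≃ End_k(M)`. -/
def evalEquiv : MonoidAlgebra M N.toSubgroup ≃ₗ[M] Module.End k M :=
  (MonoidAlgebra.coeffLinearEquiv M).trans ((galBasis φ).reindex N.pointEquiv.symm).repr.symm

theorem evalEquiv_apply (z : MonoidAlgebra M N.toSubgroup) :
    N.evalEquiv φ z = N.evalAt φ 1 z := by
  induction z using MonoidAlgebra.induction_linear with
  | zero => simp
  | add x y hx hy => rw [map_add, map_add, hx, hy]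
  | single n c =>
    simp [evalEquiv, MonoidAlgebra.coeffLinearEquiv, Module.Basis.repr_symm_apply,
      pointEquiv_apply]

theorem isBaseChange_fixedPoints : IsBaseChange M (N.fixedPoints φ).val.toLinearMap := by
  refine isBaseChange_of_range_eq_fixed φ Subtype.val_injective
    (fun g => (N.act (φ g : M →+* M) g : _ →+ _)) (fun g m v => N.act_smul _ g m v)
    (fun g h v => ?_) (fun v => ?_) fun v => ?_
  · refine Eq.trans ?_ (N.act_act _ _ g h v).symm
    rw [map_mul]
    rfl
  · refine Eq.trans ?_ (N.act_id_one v)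
    rw [map_one]
    rfl
  · exact ⟨by rintro ⟨x, rfl⟩ g; exact x.2 g, fun h => ⟨⟨v, h⟩, rfl⟩⟩

end Galois

end RegularNormalizedSubgroup

/-! ### The Hopf–Galois structure `M[N]^Γ`. -/

namespace RegularNormalizedSubgroup

variable {Γ : Type v} [Group Γ] (N : RegularNormalizedSubgroup Γ) {M : Type v} [Field M]
  {k : Type u} [Field k] [Algebra k M] (φ : Γ ≃* (M ≃ₐ[k] M))

/-- `z ↦ ∑ cₙ n⁻¹(1)(x)` as an `M`-linear form on `M[N]`. -/
def evalForm (x : M) : MonoidAlgebra M N.toSubgroup →ₗ[M] M where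
  toFun z := N.evalAt φ 1 z x
  map_add' a b := by simp
  map_smul' m a := by simp

@[simp]
theorem evalForm_apply (x : M) (z : MonoidAlgebra M N.toSubgroup) :
    N.evalForm φ x z = N.evalAt φ 1 z x := rfl

theorem evalAt_apply_mul (z : MonoidAlgebra M N.toSubgroup) (x y : M) :
    N.evalAt φ 1 z (x * y) =
      LinearMap.mul' M M (TensorProduct.map (N.evalForm φ x) (N.evalForm φ y)
        (Coalgebra.comul (R := M) z)) := by
  induction z using MonoidAlgebra.induction_linear with
  | zero => simp
  | add a b ha hb => simp [ha, hb]
  | single n c => simp [mul_left_comm]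

theorem evalAt_apply_one (z : MonoidAlgebra M N.toSubgroup) :
    N.evalAt φ 1 z 1 = Coalgebra.counit (R := M) z := by
  induction z using MonoidAlgebra.induction_linear with
  | zero => simp
  | add a b ha hb => simp [ha, hb]
  | single n c => simp

variable [FiniteDimensional k M] [IsGalois k M]

/-- The comultiplication is equivariant, so it sends fixed elements to vectors fixed by the diagonal
action, and those lie in the `k`-form by descent. -/
theorem comul_mem_range (h : N.fixedPoints φ) :
    Coalgebra.comul (R := M) ((N.fixedPoints φ).val h) ∈ LinearMap.range
      (tensorOver M (N.fixedPoints φ).val.toLinearMap (N.fixedPoints φ).val.toLinearMap) := by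
  have hb := N.isBaseChange_fixedPoints φ
  let τ : ∀ g : Γ, MonoidAlgebra M N.toSubgroup ⊗[M] MonoidAlgebra M N.toSubgroup
      →ₛₗ[(φ g : M →+* M)] MonoidAlgebra M N.toSubgroup ⊗[M] MonoidAlgebra M N.toSubgroup :=
    fun g => TensorProduct.map (N.actₛₗ (φ g : M →+* M) g) (N.actₛₗ (φ g : M →+* M) g)
  refine IsBaseChange.mem_range_of_fixed φ
    (f := tensorOver M (N.fixedPoints φ).val.toLinearMap (N.fixedPoints φ).val.toLinearMap)
    (hb.tensorOver hb)
    (fun g => (τ g).toAddMonoidHom) (fun g m v => (τ g).map_smulₛₗ m v) (fun g z => ?_) fun g => ?_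
  · change τ g _ = _
    induction z with
    | zero => simp only [map_zero]
    | add a b ha hb => rw [map_add, map_add, ha, hb]
    | tmul x y =>
      change N.act (φ g : M →+* M) g x ⊗ₜ[M] N.act (φ g : M →+* M) g y = _
      rw [x.2 g, y.2 g]
      rfl
  · refine (N.comul_act _ g _).symm.trans ?_
    exact congrArg _ (h.2 g)

theorem counit_mem_range (h : N.fixedPoints φ) :
    Coalgebra.counit (R := M) ((N.fixedPoints φ).val h) ∈
      LinearMap.range (Algebra.linearMap k M) := by
  refine (IsBaseChange.linearMap k M).mem_range_of_fixed φ
    (fun g => ((φ g : M →+* M) : M →+ M)) (fun g m v => map_mul (φ g) m v)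
    (fun g x => (φ g).commutes x) fun g => ?_
  exact (N.counit_act _ g _).symm.trans (congrArg _ (h.2 g))

theorem antipode_mem_range (h : N.fixedPoints φ) :
    HopfAlgebra.antipode M ((N.fixedPoints φ).val h) ∈
      LinearMap.range (N.fixedPoints φ).val.toLinearMap :=
  ⟨⟨_, fun g => (N.antipode_act _ g _).symm.trans (congrArg _ (h.2 g))⟩, rfl⟩

/-- The `k`-Hopf algebra structure on `M[N]^Γ`. -/
@[reducible]
def hopfAlgebraFixedPoints : HopfAlgebra k (N.fixedPoints φ) :=
  HopfAlgebra.ofIsBaseChange (M := M) (N.fixedPoints φ).val (N.isBaseChange_fixedPoints φ)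
    (N.comul_mem_range φ) (N.counit_mem_range φ) (N.antipode_mem_range φ)

theorem tensorOver_comul (h : N.fixedPoints φ) :
    tensorOver M (N.fixedPoints φ).val.toLinearMap (N.fixedPoints φ).val.toLinearMap
      ((N.hopfAlgebraFixedPoints φ).comul h) = Coalgebra.comul (R := M) (h : MonoidAlgebra M N.toSubgroup) :=
  HopfAlgebra.tensorOver_comul_ofIsBaseChange (N.fixedPoints φ).val
    (N.isBaseChange_fixedPoints φ) (N.comul_mem_range φ) (N.counit_mem_range φ)
    (N.antipode_mem_range φ) h

theorem algebraMap_counit (h : N.fixedPoints φ) :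
    algebraMap k M ((N.hopfAlgebraFixedPoints φ).counit h) =
      Coalgebra.counit (R := M) (h : MonoidAlgebra M N.toSubgroup) :=
  HopfAlgebra.algebraMap_counit_ofIsBaseChange (N.fixedPoints φ).val
    (N.isBaseChange_fixedPoints φ) (N.comul_mem_range φ) (N.counit_mem_range φ)
    (N.antipode_mem_range φ) h

omit [FiniteDimensional k M] [IsGalois k M] in
theorem evalAt_one_one : N.evalAt φ 1 1 = 1 := by
  ext x
  rw [MonoidAlgebra.one_def, evalAt_single]
  change (1 : M) • φ ((1 : Equiv.Perm Γ)⁻¹ 1) x = x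
  rw [inv_one, Equiv.Perm.one_apply, map_one, one_smul]
  rfl

/-- The action of `M[N]^Γ` on `M`. -/
def fixedPointsAction : N.fixedPoints φ →ₐ[k] Module.End k M :=
  AlgHom.ofLinearMap
    (((N.evalAt φ 1).restrictScalars k) ∘ₗ (N.fixedPoints φ).val.toLinearMap)
    (N.evalAt_one_one φ) (fun z w => N.evalAt_mul_of_fixed φ z w w.2)

omit [FiniteDimensional k M] [IsGalois k M] in
theorem mul'_map_tensorOver (x y : M) (w : N.fixedPoints φ ⊗[k] N.fixedPoints φ) :
    LinearMap.mul' M M (TensorProduct.map (N.evalForm φ x) (N.evalForm φ y)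
      (tensorOver M (N.fixedPoints φ).val.toLinearMap (N.fixedPoints φ).val.toLinearMap w)) =
    LinearMap.mul' k M (TensorProduct.map ((N.fixedPointsAction φ).toLinearMap.flip x)
      ((N.fixedPointsAction φ).toLinearMap.flip y) w) := by
  induction w with
  | zero => simp only [map_zero]
  | add a b ha hb => simp only [map_add, ha, hb]
  | tmul a b => rfl

/-- The map `j` factors as `M ⊗ M[N]^Γ ≅ M[N] ≅ End_k(M)`: descent followed by Dedekind. -/
theorem bijective_fixedPointsAction : Function.Bijective
    (LinearMap.mul' k (Module.End k M) ∘ₗ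
      TensorProduct.map (Algebra.lmul k M).toLinearMap (N.fixedPointsAction φ).toLinearMap) := by
  convert ((N.isBaseChange_fixedPoints φ).equiv.trans (N.evalEquiv φ)).bijective using 1
  funext z
  induction z with
  | zero => simp only [map_zero]
  | add a b ha hb => rw [map_add, map_add, ha, hb]
  | tmul m h =>
    rw [LinearEquiv.trans_apply, IsBaseChange.equiv_tmul, map_smul, evalEquiv_apply]
    rfl

/-- The Hopf–Galois structure `M[N]^Γ`. -/
def toHopfGaloisStructure : HopfGaloisStructure k M :=
  letI := N.hopfAlgebraFixedPoints φ
  { carrier := N.fixedPoints φ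
    action := N.fixedPointsAction φ
    action_one := fun h => (N.evalAt_apply_one φ h).trans (N.algebraMap_counit φ h).symm
    action_mul := fun h x y => by
      refine (N.evalAt_apply_mul φ h x y).trans ?_
      rw [← N.tensorOver_comul φ h, mul'_map_tensorOver]
    bijective := N.bijective_fixedPointsAction φ }

/-- `M[N]^Γ` corresponds to `N`. -/
def greitherPareigisIso : GreitherPareigisIso φ (N.toHopfGaloisStructure φ) N where
  toAlgEquiv := AlgEquiv.refl
  comul_eq h := (N.tensorOver_comul φ h).symm
  counit_eq h := (N.algebraMap_counit φ h).symm
  action_eq h x := N.evalAt_one_apply φ (show N.fixedPoints φ from h) x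

end RegularNormalizedSubgroup

/-! ### The action determines tensors in `A ⊗ A`. -/

section Pairing

open RegularNormalizedSubgroup

variable {Γ : Type v} [Group Γ] {M : Type v} [Field M] {k : Type u} [Field k] [Algebra k M]
  {A : Type*} [AddCommGroup A] [Module M A]

/-- Evaluation at `x` of an `M`-linear family of endomorphisms. -/
def evalLin (f : A →ₗ[M] Module.End k M) (x : M) : A →ₗ[M] M where
  toFun z := f z x
  map_add' a b := by simp
  map_smul' m a := by simp

@[simp]
theorem evalLin_apply (f : A →ₗ[M] Module.End k M) (x : M) (z : A) : evalLin f x z = f z x := rfl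

/-- The pairing of `A ⊗[M] A` with a pair of elements of `M`. -/
def evalPair (f : A →ₗ[M] Module.End k M) (x y : M) : A ⊗[M] A →ₗ[M] M :=
  LinearMap.mul' M M ∘ₗ TensorProduct.map (evalLin f x) (evalLin f y)

@[simp]
theorem evalPair_tmul (f : A →ₗ[M] Module.End k M) (x y : M) (a b : A) :
    evalPair f x y (a ⊗ₜ[M] b) = f a x * f b y := rfl

/-- Elements of `A ⊗[M] A`, where `A ≃ End_k(M)`, are determined by their pairings. -/
theorem eq_of_evalPair_eq [FiniteDimensional k M] [IsGalois k M] (φ : Γ ≃* (M ≃ₐ[k] M))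
    (e : A ≃ₗ[M] Module.End k M) {ω ω' : A ⊗[M] A}
    (h : ∀ x y, evalPair e.toLinearMap x y ω = evalPair e.toLinearMap x y ω') : ω = ω' := by
  have := finite_of_mulEquiv_gal φ
  have := Fintype.ofFinite Γ
  let b : Module.Basis Γ M A := (galBasis φ).map e.symm
  have hb : ∀ g, e (b g) = (φ g).toLinearMap := fun g => by simp [b]
  rw [← sub_eq_zero]
  generalize hη : ω - ω' = η
  have h0 : ∀ x y, evalPair e.toLinearMap x y η = 0 := fun x y => by
    rw [← hη, map_sub, h, sub_self]
  let B := b.tensorProduct b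
  have hexp : ∀ x y, ∑ g : Γ, (∑ h : Γ, B.repr η (g, h) * φ h y) * φ g x = 0 := by
    intro x y
    rw [← h0 x y]
    conv_rhs => rw [← B.sum_repr η, map_sum, Fintype.sum_prod_type]
    refine Finset.sum_congr rfl fun g _ => ?_
    rw [Finset.sum_mul]
    refine Finset.sum_congr rfl fun h _ => ?_
    rw [map_smul, Module.Basis.tensorProduct_apply, evalPair_tmul]
    simp only [LinearEquiv.coe_coe, hb, AlgEquiv.toLinearMap_apply, smul_eq_mul]
    ring
  -- Dedekind is used twice: in `x` to separate the indices `g`, then in `y` to separate the indices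
  -- `h`.
  have li := Fintype.linearIndependent_iff.mp (linearIndependent_gal φ)
  have hz : ∀ g h, B.repr η (g, h) = 0 := by
    intro g
    refine li _ ?_
    ext y
    have := li (fun g => ∑ h : Γ, B.repr η (g, h) * φ h y) (by
      ext x
      simpa using hexp x y) g
    simpa using this
  apply B.repr.injective
  ext ⟨g, h⟩
  simp [hz]

end Pairing

/-! ### Group-like elements of `M ⊗ H` and the regular subgroup they define. -/

theorem TensorProduct.comul_one_tmul' {k M H : Type*} [Field k] [Field M] [Algebra k M] [Ring H]
    [HopfAlgebra k H] (h : H) :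
    Coalgebra.comul (R := M) ((1 : M) ⊗ₜ[k] h) =
      tensorOver M (TensorProduct.mk k M H 1) (TensorProduct.mk k M H 1)
        (Coalgebra.comul (R := k) h) := by
  rw [TensorProduct.comul_tmul]
  generalize Coalgebra.comul (R := k) h = w
  induction w with
  | zero => simp
  | add a b ha hb => rw [TensorProduct.tmul_add, map_add, map_add, ha, hb]
  | tmul a b => simp

namespace HopfGaloisStructure

open RegularNormalizedSubgroup

variable {Γ : Type v} [Group Γ] {M : Type v} [Field M] {k : Type u} [Field k] [Algebra k M]
  (S : HopfGaloisStructure k M)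

/-- The isomorphism `j : M ⊗ H ≃ End_k(M)`, as an `M`-linear map. -/
def j : M ⊗[k] S.carrier ≃ₗ[M] Module.End k M :=
  LinearEquiv.ofBijective (LinearMap.liftBaseChange M S.action.toLinearMap) (by
    convert S.bijective using 1
    funext z
    induction z with
    | zero => simp only [map_zero]
    | add a b ha hb => rw [map_add, map_add, ha, hb]
    | tmul m h =>
      ext x
      simp)

@[simp]
theorem j_tmul (m : M) (h : S.carrier) (x : M) : S.j (m ⊗ₜ[k] h) x = m * S.action h x := by
  change (LinearMap.liftBaseChange M S.action.toLinearMap (m ⊗ₜ[k] h)) x = _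
  simp

theorem j_one_tmul (h : S.carrier) : S.j ((1 : M) ⊗ₜ[k] h) = S.action h := by
  ext x
  simp

/-- In the tensor product algebra `M` commutes with `H`, whereas `H` acts on `M` inside `End_k(M)`.
So `j` is not multiplicative, and this formula replaces multiplicativity. -/
theorem j_mul_tmul (u : M ⊗[k] S.carrier) (m : M) (h : S.carrier) (x : M) :
    S.j (u * m ⊗ₜ[k] h) x = m * S.j u (S.action h x) := by
  induction u with
  | zero => simp
  | add a b ha hb => rw [add_mul, map_add, LinearMap.add_apply, ha, hb, map_add,
      LinearMap.add_apply, mul_add]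
  | tmul a b =>
    simp only [Algebra.TensorProduct.tmul_mul_tmul, j_tmul, map_mul, Module.End.mul_apply]
    ring

theorem j_apply_one (z : M ⊗[k] S.carrier) : S.j z 1 = Coalgebra.counit (R := M) z := by
  induction z with
  | zero => simp
  | add a b ha hb => rw [map_add, LinearMap.add_apply, ha, hb, map_add]
  | tmul m h =>
    rw [j_tmul, S.action_one, TensorProduct.counit_tmul, Algebra.smul_def, mul_comm]
    rfl

theorem evalPair_tensorOver {A : Type*} [AddCommGroup A] [Module M A] [Module k A]
    [IsScalarTower k M A] (f : A →ₗ[M] Module.End k M) (i : S.carrier →ₗ[k] A)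
    (hi : ∀ h x, f (i h) x = S.action h x) (x y : M) (w : S.carrier ⊗[k] S.carrier) :
    evalPair f x y (tensorOver M i i w) =
      LinearMap.mul' k M (TensorProduct.map (S.action.toLinearMap.flip x)
        (S.action.toLinearMap.flip y) w) := by
  induction w with
  | zero => simp only [map_zero]
  | add a b ha hb => simp only [map_add, ha, hb]
  | tmul a b => simp [hi]

theorem j_apply_mul (z : M ⊗[k] S.carrier) (x y : M) :
    S.j z (x * y) = evalPair S.j.toLinearMap x y (Coalgebra.comul (R := M) z) := by
  induction z with
  | zero => simp
  | add a b ha hb => rw [map_add, LinearMap.add_apply, ha, hb, map_add, map_add]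
  | tmul m h =>
    have : m ⊗ₜ[k] h = m • ((1 : M) ⊗ₜ[k] h) := by simp [TensorProduct.smul_tmul']
    rw [this, map_smul, map_smul, map_smul, TensorProduct.comul_one_tmul',
      S.evalPair_tensorOver _ _ (fun h x => by simp), ← S.action_mul, LinearMap.smul_apply,
      j_one_tmul]

variable [FiniteDimensional k M] [IsGalois k M] (φ : Γ ≃* (M ≃ₐ[k] M))

/-- The element of `M ⊗ H` acting as the automorphism `g`. -/
def gl (g : Γ) : M ⊗[k] S.carrier := S.j.symm (φ g).toLinearMap

omit [FiniteDimensional k M] [IsGalois k M] in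
@[simp]
theorem j_gl (g : Γ) : S.j (S.gl φ g) = (φ g).toLinearMap := by simp [gl]

omit [FiniteDimensional k M] [IsGalois k M] in
theorem gl_injective : Function.Injective (S.gl φ) := fun a b h => by
  apply φ.injective
  ext x
  have := congrArg (fun z => S.j z x) h
  simpa using this

omit [FiniteDimensional k M] [IsGalois k M] in
theorem gl_one : S.gl φ 1 = 1 := by
  apply S.j.injective
  rw [j_gl, Algebra.TensorProduct.one_def, j_one_tmul, map_one, map_one]
  rfl

/-- Preserving `1` is having counit `1`, and preserving products is `Δ z = z ⊗ z` tested on all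
pairs `x, y`. -/
theorem isGroupLikeElem_gl (g : Γ) : IsGroupLikeElem M (S.gl φ g) where
  counit_eq_one := by simp [← j_apply_one]
  comul_eq_tmul_self := by
    refine eq_of_evalPair_eq φ S.j fun x y => ?_
    rw [← j_apply_mul]
    simp

/-- A group-like element acts by a `k`-algebra endomorphism of `M`, which is an automorphism because
`M/k` is algebraic. -/
theorem exists_eq_gl_of_isGroupLikeElem {z : M ⊗[k] S.carrier} (hz : IsGroupLikeElem M z) :
    ∃ g, S.gl φ g = z := by
  let f : M →ₐ[k] M := AlgHom.ofLinearMap (S.j z) (by rw [j_apply_one, hz.counit_eq_one])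
    fun x y => by rw [j_apply_mul, hz.comul_eq_tmul_self]; simp
  refine ⟨φ.symm (AlgEquiv.ofBijective f (Algebra.IsAlgebraic.algHom_bijective f)), ?_⟩
  apply S.j.injective
  ext x
  simp [f]

/-- The Galois group is in bijection with the group-like elements of `M ⊗ H`. -/
def groupLikeEquiv : Γ ≃ GroupLike M (M ⊗[k] S.carrier) :=
  Equiv.ofBijective (fun g => ⟨S.gl φ g, S.isGroupLikeElem_gl φ g⟩)
    ⟨fun _ _ h => S.gl_injective φ (congrArg GroupLike.val h), fun z => by
      obtain ⟨g, hg⟩ := S.exists_eq_gl_of_isGroupLikeElem φ z.2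
      exact ⟨g, GroupLike.ext hg⟩⟩

@[simp]
theorem groupLikeEquiv_val (g : Γ) : (S.groupLikeEquiv φ g).val = S.gl φ g := rfl

@[simp]
theorem gl_groupLikeEquiv_symm (a : GroupLike M (M ⊗[k] S.carrier)) :
    S.gl φ ((S.groupLikeEquiv φ).symm a) = a.val := by
  rw [← groupLikeEquiv_val, Equiv.apply_symm_apply]

theorem groupLikeEquiv_one : S.groupLikeEquiv φ 1 = 1 := GroupLike.ext (S.gl_one φ)

/-- The semilinear action of the Galois group on `M ⊗ H`. -/
def galTensor (γ : Γ) : M ⊗[k] S.carrier →ₗ[k] M ⊗[k] S.carrier :=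
  TensorProduct.map (φ γ).toLinearMap LinearMap.id

omit [FiniteDimensional k M] [IsGalois k M] in
theorem galTensor_mul (γ δ : Γ) (z : M ⊗[k] S.carrier) :
    S.galTensor φ (γ * δ) z = S.galTensor φ γ (S.galTensor φ δ z) := by
  induction z with
  | zero => simp
  | add a b ha hb => simp only [map_add, ha, hb]
  | tmul a b => simp [galTensor]

omit [FiniteDimensional k M] [IsGalois k M] in
theorem j_galTensor (γ : Γ) (z : M ⊗[k] S.carrier) (x : M) :
    S.j (S.galTensor φ γ z) x = φ γ (S.j (S.gl φ γ⁻¹ * z) x) := by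
  induction z with
  | zero => simp
  | add a b ha hb => simp only [mul_add, map_add, LinearMap.add_apply, ha, hb]
  | tmul a b => simp [galTensor, j_mul_tmul]

/-- The Galois action permutes the group-likes; the formula expresses it through the two group laws
alone, those of `Γ` and of the group-likes. -/
theorem galTensor_gl (γ : Γ) (a : GroupLike M (M ⊗[k] S.carrier)) :
    S.galTensor φ γ a.val =
      S.gl φ (γ * (S.groupLikeEquiv φ).symm (S.groupLikeEquiv φ γ⁻¹ * a)) := by
  apply S.j.injective
  ext x
  rw [j_galTensor, j_gl]
  have : S.gl φ γ⁻¹ * a.val =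
      S.gl φ ((S.groupLikeEquiv φ).symm (S.groupLikeEquiv φ γ⁻¹ * a)) := by simp
  rw [this, j_gl]
  simp

/-- The group of group-like elements acts on the Galois group by (inverse) right translations. -/
def groupLikePerm : GroupLike M (M ⊗[k] S.carrier) →* Equiv.Perm Γ where
  toFun a := (S.groupLikeEquiv φ).symm.permCongr (Equiv.mulRight a⁻¹)
  map_one' := by ext; simp [Equiv.permCongr_apply]
  map_mul' a b := by ext; simp [Equiv.permCongr_apply, mul_assoc]

theorem groupLikePerm_apply (a : GroupLike M (M ⊗[k] S.carrier)) (x : Γ) :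
    S.groupLikePerm φ a x = (S.groupLikeEquiv φ).symm (S.groupLikeEquiv φ x * a⁻¹) := rfl

theorem groupLikePerm_inv_apply (a : GroupLike M (M ⊗[k] S.carrier)) (x : Γ) :
    (S.groupLikePerm φ a)⁻¹ x = (S.groupLikeEquiv φ).symm (S.groupLikeEquiv φ x * a) := by
  rw [← map_inv, groupLikePerm_apply, inv_inv]

theorem conj_groupLikePerm_mem (γ : Γ) (a : GroupLike M (M ⊗[k] S.carrier)) :
    MulAction.toPermHom Γ Γ γ * S.groupLikePerm φ a * (MulAction.toPermHom Γ Γ γ)⁻¹ ∈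
      (S.groupLikePerm φ).range := by
  let E := S.groupLikeEquiv φ
  let r : Γ → GroupLike M (M ⊗[k] S.carrier) → GroupLike M (M ⊗[k] S.carrier) :=
    fun γ a => E (γ * E.symm (E γ⁻¹ * a))
  have hr : ∀ γ a, (r γ a).val = S.galTensor φ γ a.val := fun γ a => (S.galTensor_gl φ γ a).symm
  -- Here `r` is the Galois action on group-likes. Cancelling `x⁻¹` in this action law gives exactly
  -- the value at `x` of the inverse of `λ(γ)` conjugating the permutation of `a`, so that conjugate
  -- is the permutation of `r γ a`.
  have hrr : ∀ x, r x⁻¹ (r γ a) = r (x⁻¹ * γ) a := fun x => GroupLike.ext (by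
    rw [hr, hr, hr, galTensor_mul])
  refine ⟨r γ a, ?_⟩
  apply inv_injective
  ext x
  have h := E.injective (hrr x)
  rw [inv_inv, mul_assoc, mul_right_inj, mul_inv_rev, inv_inv] at h
  rw [groupLikePerm_inv_apply]
  refine h.trans ?_
  rw [mul_inv_rev, mul_inv_rev, inv_inv]
  change _ = γ * (S.groupLikePerm φ a)⁻¹ ((MulAction.toPermHom Γ Γ γ)⁻¹ x)
  rw [groupLikePerm_inv_apply, ← map_inv]
  rfl

/-- The regular subgroup attached to a Hopf–Galois structure. -/
def toRegular : RegularNormalizedSubgroup Γ where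
  toSubgroup := (S.groupLikePerm φ).range
  regular x y := by
    let E := S.groupLikeEquiv φ
    refine ⟨⟨_, (E y)⁻¹ * E x, rfl⟩, ?_, ?_⟩
    · change S.groupLikePerm φ _ x = y
      rw [groupLikePerm_apply]
      simp [E]
    · rintro ⟨_, a, rfl⟩ h
      have h' : E.symm (E x * a⁻¹) = y := h
      have : a = (E y)⁻¹ * E x := by rw [← h']; simp
      rw [this]
  normalized := by
    rintro γ _ ⟨a, rfl⟩
    exact S.conj_groupLikePerm_mem φ γ a

/-- `N` and `H` are compatible if `n ↦ j⁻¹(n⁻¹(1))` is multiplicative. -/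
def Compatible (N : RegularNormalizedSubgroup Γ) : Prop :=
  ∀ n m : N.toSubgroup,
    S.gl φ (N.pointEquiv (n * m)) = S.gl φ (N.pointEquiv n) * S.gl φ (N.pointEquiv m)

/-- The inverse in the definition of `groupLikePerm` makes `n⁻¹(1)` the point of `Γ` corresponding
to `a` when `n` is the permutation of `a`. -/
theorem compatible_toRegular : S.Compatible φ (S.toRegular φ) := by
  have key : ∀ a, S.gl φ ((S.groupLikePerm φ a)⁻¹ 1) = a.val := fun a => by
    rw [groupLikePerm_inv_apply, groupLikeEquiv_one, one_mul, gl_groupLikeEquiv_symm]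
  rintro ⟨_, a, rfl⟩ ⟨_, b, rfl⟩
  change S.gl φ ((S.groupLikePerm φ a * S.groupLikePerm φ b)⁻¹ 1) =
    S.gl φ ((S.groupLikePerm φ a)⁻¹ 1) * S.gl φ ((S.groupLikePerm φ b)⁻¹ 1)
  rw [← map_mul, key, key, key, GroupLike.val_mul]

omit [FiniteDimensional k M] [IsGalois k M] in
-- By regularity every point is `m⁻¹(1)`, and `n⁻¹` sends it to `(m n)⁻¹(1)`. Compatibility computes
-- this from `m⁻¹(1)` and `n⁻¹(1)` by the product in `M ⊗ H`, which does not involve `N`.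
theorem Compatible.eq {N N' : RegularNormalizedSubgroup Γ} (hN : S.Compatible φ N)
    (hN' : S.Compatible φ N') : N = N' := by
  have key : ∀ {N N' : RegularNormalizedSubgroup Γ}, S.Compatible φ N → S.Compatible φ N' →
      N.toSubgroup ≤ N'.toSubgroup := by
    intro N N' hN hN' n hn
    obtain ⟨n', hn'⟩ := N'.pointEquiv.surjective (N.pointEquiv ⟨n, hn⟩)
    suffices h : n⁻¹ = (n' : Equiv.Perm Γ)⁻¹ by
      rw [inv_injective h]
      exact n'.2
    ext x
    obtain ⟨m, rfl⟩ := N.pointEquiv.surjective x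
    obtain ⟨m', hm'⟩ := N'.pointEquiv.surjective (N.pointEquiv m)
    apply S.gl_injective φ
    have h1 := hN m ⟨n, hn⟩
    have h2 := hN' m' n'
    rw [hn', hm', ← h1] at h2
    exact h2.symm.trans (by rw [← hm']; rfl)
  exact RegularNormalizedSubgroup.ext' (le_antisymm (key hN hN') (key hN' hN))

end HopfGaloisStructure

/-! ### The Greither–Pareigis correspondence. -/

section

variable {Γ : Type v} [Group Γ] {M : Type v} [Field M] {k : Type u} [Field k] [Algebra k M]
  {φ : Γ ≃* (M ≃ₐ[k] M)} {S T : HopfGaloisStructure k M} {N N' : RegularNormalizedSubgroup Γ}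

theorem GreitherPareigisIso.action_eq_evalAt (ψ : GreitherPareigisIso φ S N) (h : S.carrier) :
    S.action h = N.evalAt φ 1 (ψ.toAlgEquiv h : MonoidAlgebra M N.toSubgroup) := by
  ext x
  rw [ψ.action_eq, RegularNormalizedSubgroup.evalAt_one_apply]

variable [FiniteDimensional k M] [IsGalois k M]

/-- An isomorphism of algebras compatible with the actions is one of Hopf algebras. -/
def GreitherPareigisIso.ofAction (ψ : S.carrier ≃ₐ[k] N.fixedPoints φ)
    (hψ : ∀ h, S.action h = N.evalAt φ 1 (ψ h : MonoidAlgebra M N.toSubgroup)) :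
    GreitherPareigisIso φ S N where
  toAlgEquiv := ψ
  comul_eq h := by
    refine eq_of_evalPair_eq φ (N.evalEquiv φ) fun x y => ?_
    have he : (N.evalEquiv φ).toLinearMap = N.evalAt φ 1 :=
      LinearMap.ext fun z => N.evalEquiv_apply φ z
    rw [he]
    refine (N.evalAt_apply_mul φ (ψ h) x y).symm.trans ?_
    rw [← hψ, S.action_mul]
    exact (S.evalPair_tensorOver (N.evalAt φ 1)
      ((N.fixedPoints φ).val.comp ψ.toAlgHom).toLinearMap
      (fun h x => by rw [hψ]; rfl) x y _).symm
  counit_eq h := by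
    rw [← N.evalAt_apply_one φ, ← hψ, S.action_one]
  action_eq h x := by rw [hψ, RegularNormalizedSubgroup.evalAt_one_apply]

/-- An isomorphism of algebras compatible with the actions is one of Hopf algebras. -/
def HopfGaloisStructure.bialgEquivOfAction (φ : Γ ≃* (M ≃ₐ[k] M)) (f : S.carrier ≃ₐ[k] T.carrier)
    (hf : ∀ h, T.action (f h) = S.action h) : S.carrier ≃ₐc[k] T.carrier :=
  BialgEquiv.ofAlgEquiv f
    (by
      ext h
      apply (algebraMap k M).injective
      change algebraMap k M (Coalgebra.counit (R := k) (f h)) =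
        algebraMap k M (Coalgebra.counit (R := k) h)
      rw [← S.action_one, ← T.action_one, hf])
    (by
      ext h
      -- Both comultiplications are moved to `(M ⊗ T) ⊗[M] (M ⊗ T)`, where pairings with `x, y`
      -- reduce them to the actions on `x * y`.
      have hb := TensorProduct.isBaseChange k T.carrier M
      apply (hb.tensorOver hb).injective_of_field
      refine eq_of_evalPair_eq φ T.j fun x y => ?_
      have h1 : ∀ w, tensorOver M (TensorProduct.mk k M T.carrier 1)
          (TensorProduct.mk k M T.carrier 1) (TensorProduct.map f.toLinearMap f.toLinearMap w) =
          tensorOver M (TensorProduct.mk k M T.carrier 1 ∘ₗ f.toLinearMap)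
            (TensorProduct.mk k M T.carrier 1 ∘ₗ f.toLinearMap) w := by
        intro w
        induction w with
        | zero => simp only [map_zero]
        | add a b ha hb => simp only [map_add, ha, hb]
        | tmul a b => rfl
      refine (congrArg _ (h1 (Coalgebra.comul (R := k) h))).trans ?_
      rw [S.evalPair_tensorOver T.j.toLinearMap _ (fun h x => by simp [hf])]
      rw [← S.action_mul, ← hf, T.action_mul]
      exact (T.evalPair_tensorOver _ _ (fun h x => by simp) x y _).symm)

theorem GreitherPareigisIso.compatible (ψ : GreitherPareigisIso φ S N) : S.Compatible φ N := by
  let Θ : MonoidAlgebra M N.toSubgroup ≃ₗ[M] M ⊗[k] S.carrier :=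
    (N.evalEquiv φ).trans S.j.symm
  have hΘj : ∀ z, S.j (Θ z) = N.evalAt φ 1 z := fun z => by
    simp [Θ, RegularNormalizedSubgroup.evalEquiv_apply]
  have hψ : ∀ h, Θ (ψ.toAlgEquiv h : MonoidAlgebra M N.toSubgroup) = 1 ⊗ₜ[k] h := fun h => by
    apply S.j.injective
    rw [hΘj, S.j_one_tmul, ψ.action_eq_evalAt]
  -- By `M`-linearity the right factor may be taken in `M[N]^Γ`; there evaluation is multiplicative
  -- and `j_mul_tmul` gives the same rule for `j`.
  have hmul : ∀ z w, Θ (z * w) = Θ z * Θ w := by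
    intro z w
    obtain ⟨w, rfl⟩ := Θ.symm.surjective w
    rw [LinearEquiv.apply_symm_apply]
    induction w with
    | zero => simp
    | add a b ha hb => simp only [map_add, mul_add, ha, hb]
    | tmul m h =>
      have h1 : m ⊗ₜ[k] h = m • ((1 : M) ⊗ₜ[k] h) := by simp [TensorProduct.smul_tmul']
      rw [h1, map_smul, mul_smul_comm, map_smul, mul_smul_comm, ← hψ,
        LinearEquiv.symm_apply_apply]
      congr 1
      apply S.j.injective
      ext x
      rw [hΘj, N.evalAt_mul_of_fixed φ _ _ (ψ.toAlgEquiv h).2, hψ, S.j_mul_tmul, hΘj, one_mul,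
        Module.End.mul_apply, ψ.action_eq_evalAt]
  have hs : ∀ n : N.toSubgroup, Θ (MonoidAlgebra.single n 1) = S.gl φ (N.pointEquiv n) := by
    intro n
    apply S.j.injective
    rw [hΘj, S.j_gl, N.evalAt_single, one_smul]
    rfl
  intro n m
  rw [← hs, ← hs, ← hs, ← hmul, MonoidAlgebra.single_mul_single, one_mul]

theorem HopfGaloisStructure.Compatible.nonempty_greitherPareigisIso (hc : S.Compatible φ N) :
    Nonempty (GreitherPareigisIso φ S N) := by
  let Θ : MonoidAlgebra M N.toSubgroup ≃ₗ[M] M ⊗[k] S.carrier :=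
    (N.evalEquiv φ).trans S.j.symm
  have hΘj : ∀ z, S.j (Θ z) = N.evalAt φ 1 z := fun z => by
    simp [Θ, RegularNormalizedSubgroup.evalEquiv_apply]
  have hs : ∀ (n : N.toSubgroup) (c : M),
      Θ (MonoidAlgebra.single n c) = c • S.gl φ (N.pointEquiv n) := by
    intro n c
    apply S.j.injective
    rw [hΘj, map_smul, S.j_gl, N.evalAt_single]
    rfl
  have hmul : ∀ z w, Θ (z * w) = Θ z * Θ w := by
    intro z w
    induction z using MonoidAlgebra.induction_linear with
    | zero => simp
    | add a b ha hb => simp only [map_add, add_mul, ha, hb]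
    | single n c =>
      induction w using MonoidAlgebra.induction_linear with
      | zero => simp
      | add a b ha hb => simp only [map_add, mul_add, ha, hb]
      | single m d =>
        rw [MonoidAlgebra.single_mul_single, hs, hs, hs, hc, smul_mul_smul_comm]
  have hone : Θ 1 = 1 := by
    apply S.j.injective
    rw [hΘj, N.evalAt_one_one, Algebra.TensorProduct.one_def, S.j_one_tmul, map_one]
  have hmul' : ∀ z w, Θ.symm (z * w) = Θ.symm z * Θ.symm w := fun z w => by
    apply Θ.injective
    simp [hmul]
  have hone' : Θ.symm 1 = 1 := by rw [← hone, LinearEquiv.symm_apply_apply]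
  have hev : ∀ h : S.carrier, N.evalAt φ 1 (Θ.symm (1 ⊗ₜ[k] h)) = S.action h := fun h => by
    rw [← hΘj, LinearEquiv.apply_symm_apply, S.j_one_tmul]
  -- With `m⁻¹(1) = g⁻¹`, evaluating at `g⁻¹` is multiplying by `m` and evaluating at `1`.
  -- Multiplicativity of `Θ` turns this into `φ g⁻¹` after the action of `h`, and `φ g` cancels it.
  have hfix : ∀ (h : S.carrier) (g : Γ),
      N.act (φ g : M →+* M) g (Θ.symm (1 ⊗ₜ[k] h)) = Θ.symm (1 ⊗ₜ[k] h) := by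
    intro h g
    apply (N.evalEquiv φ).injective
    rw [N.evalEquiv_apply, N.evalEquiv_apply, hev]
    ext x
    obtain ⟨m, hm⟩ := N.pointEquiv.surjective g⁻¹
    have h1 : N.evalAt φ g⁻¹ (Θ.symm (1 ⊗ₜ[k] h)) x = φ g⁻¹ (S.action h x) := by
      have h2 := N.evalAt_single_mul φ 1 m 1 (Θ.symm (1 ⊗ₜ[k] h))
      rw [one_smul, ← N.pointEquiv_apply, hm] at h2
      rw [← h2, ← hΘj, hmul, hs, one_smul, hm, LinearEquiv.apply_symm_apply, S.j_mul_tmul,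
        one_mul, S.j_gl, AlgEquiv.toLinearMap_apply]
    have h3 := N.apply_evalAt φ g g⁻¹ (Θ.symm (1 ⊗ₜ[k] h)) x
    rw [h1, mul_inv_cancel] at h3
    rw [← h3, ← AlgEquiv.mul_apply, ← map_mul, mul_inv_cancel, map_one, AlgEquiv.one_apply]
  let ψ : S.carrier →ₐ[k] N.fixedPoints φ :=
    AlgHom.ofLinearMap
      { toFun := fun h => (⟨Θ.symm (1 ⊗ₜ[k] h), hfix h⟩ : N.fixedPoints φ)
        map_add' := fun a b => Subtype.ext (by simp [TensorProduct.tmul_add])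
        map_smul' := fun c a => Subtype.ext (by
          change Θ.symm (1 ⊗ₜ[k] (c • a)) = c • Θ.symm (1 ⊗ₜ[k] a)
          rw [TensorProduct.tmul_smul, ← algebraMap_smul M c, map_smul, algebraMap_smul]) }
      (Subtype.ext hone')
      fun a b => Subtype.ext (by
        change Θ.symm (1 ⊗ₜ[k] (a * b)) = Θ.symm (1 ⊗ₜ[k] a) * Θ.symm (1 ⊗ₜ[k] b)
        rw [← hmul', Algebra.TensorProduct.tmul_mul_tmul, one_mul])
  -- The same computation reversed: if `z` is fixed then `Θ z` is Galois-fixed in `M ⊗ H`, hence of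
  -- the form `1 ⊗ h`.
  have hsurj : Function.Surjective ψ := by
    intro z
    obtain ⟨h, hh⟩ := (TensorProduct.isBaseChange k S.carrier M).mem_range_of_fixed φ
      (fun g => (S.galTensor φ g).toAddMonoidHom) (v := Θ z.1)
      (fun g m v => by
        change S.galTensor φ g (m • v) = φ g m • S.galTensor φ g v
        induction v with
        | zero => simp
        | add a b ha hb => simp only [smul_add, map_add, ha, hb]
        | tmul a b => simp [galTensor, TensorProduct.smul_tmul'])
      (fun g x => by
        change S.galTensor φ g (1 ⊗ₜ[k] x) = 1 ⊗ₜ[k] x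
        simp [galTensor])
      (fun g => by
        change S.galTensor φ g (Θ z.1) = Θ z.1
        apply S.j.injective
        ext x
        obtain ⟨m, hm⟩ := N.pointEquiv.surjective g⁻¹
        have h2 := N.evalAt_single_mul φ 1 m 1 z.1
        rw [one_smul, ← N.pointEquiv_apply, hm] at h2
        have h3 : S.gl φ g⁻¹ = Θ (MonoidAlgebra.single m 1) := by rw [hs, one_smul, hm]
        rw [S.j_galTensor, h3, ← hmul, hΘj, h2, N.apply_evalAt, z.2 g, mul_inv_cancel, hΘj])
    refine ⟨h, Subtype.ext ?_⟩
    change Θ.symm (1 ⊗ₜ[k] h) = z.1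
    exact (LinearEquiv.symm_apply_eq Θ).mpr hh
  have hinj : Function.Injective ψ := fun a b hab =>
    (TensorProduct.isBaseChange k S.carrier M).injective_of_field
      (Θ.symm.injective (congrArg Subtype.val hab))
  exact ⟨GreitherPareigisIso.ofAction (AlgEquiv.ofBijective ψ ⟨hinj, hsurj⟩) fun h => (hev h).symm⟩

theorem nonempty_greitherPareigisIso_iff :
    Nonempty (GreitherPareigisIso φ S N) ↔ S.Compatible φ N :=
  ⟨fun ⟨ψ⟩ => ψ.compatible, fun h => h.nonempty_greitherPareigisIso⟩

theorem GreitherPareigisIso.equiv (ψ : GreitherPareigisIso φ S N) (χ : GreitherPareigisIso φ T N) :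
    S ≈ T := by
  have h : ∀ h, T.action (χ.toAlgEquiv.symm (ψ.toAlgEquiv h)) = S.action h := fun h => by
    rw [χ.action_eq_evalAt, AlgEquiv.apply_symm_apply, ψ.action_eq_evalAt]
  exact ⟨HopfGaloisStructure.bialgEquivOfAction φ (ψ.toAlgEquiv.trans χ.toAlgEquiv.symm) h,
    fun a x => DFunLike.congr_fun (h a) x⟩

theorem GreitherPareigisIso.nonempty_of_equiv (h : S ≈ T) (χ : GreitherPareigisIso φ T N) :
    Nonempty (GreitherPareigisIso φ S N) := by
  obtain ⟨f, hf⟩ := h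
  refine ⟨GreitherPareigisIso.ofAction ((f : S.carrier ≃ₐ[k] T.carrier).trans χ.toAlgEquiv)
    fun a => ?_⟩
  rw [AlgEquiv.trans_apply, ← χ.action_eq_evalAt]
  ext x
  exact (hf a x).symm

/-- The Greither–Pareigis correspondence. -/
def greitherPareigisEquiv (φ : Γ ≃* (M ≃ₐ[k] M)) :
    HopfGaloisClass k M ≃ RegularNormalizedSubgroup Γ where
  toFun := Quotient.lift (fun S => S.toRegular φ) fun S T h =>
    (S.compatible_toRegular φ).eq S φ (by
      obtain ⟨χ⟩ := (T.compatible_toRegular φ).nonempty_greitherPareigisIso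
      exact nonempty_greitherPareigisIso_iff.mp (χ.nonempty_of_equiv h))
  invFun N := (N.toHopfGaloisStructure φ).cls
  left_inv c := by
    induction c using Quotient.inductionOn with
    | h S =>
      obtain ⟨χ⟩ := (S.compatible_toRegular φ).nonempty_greitherPareigisIso
      exact Quotient.sound (((S.toRegular φ).greitherPareigisIso φ).equiv χ)
  right_inv N := ((N.toHopfGaloisStructure φ).compatible_toRegular φ).eq _ φ
    (N.greitherPareigisIso φ).compatible

theorem greitherPareigisEquiv_cls (φ : Γ ≃* (M ≃ₐ[k] M)) (S : HopfGaloisStructure k M)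
    (N : RegularNormalizedSubgroup Γ) :
    greitherPareigisEquiv φ S.cls = N ↔ Nonempty (GreitherPareigisIso φ S N) := by
  rw [nonempty_greitherPareigisIso_iff]
  exact ⟨fun h => h ▸ S.compatible_toRegular φ, fun h => (S.compatible_toRegular φ).eq S φ h⟩

end

/-! ### Transport along a group isomorphism and the inclusion `F[N] ⊆ L[N']`. -/

namespace RegularNormalizedSubgroup

variable {Γ Δ : Type v} [Group Γ] [Group Δ]

/-- Transport of a regular subgroup along an isomorphism of groups. -/
def transport (q : Γ ≃* Δ) (N : RegularNormalizedSubgroup Γ) : RegularNormalizedSubgroup Δ where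
  toSubgroup := N.toSubgroup.map q.toEquiv.permCongrHom.toMonoidHom
  regular x y := by
    obtain ⟨n, hn, hu⟩ := N.regular (q.symm x) (q.symm y)
    refine ⟨⟨_, n, n.2, rfl⟩, ?_, ?_⟩
    · change q ((n : Equiv.Perm Γ) (q.symm x)) = y
      rw [hn, MulEquiv.apply_symm_apply]
    · rintro ⟨_, m, hm, rfl⟩ h
      have h' : q (m (q.symm x)) = y := h
      have : (⟨m, hm⟩ : N.toSubgroup) = n := hu _ (by rw [← h', MulEquiv.symm_apply_apply])
      rw [← this]
  normalized := by
    rintro g _ ⟨n, hn, rfl⟩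
    refine ⟨_, N.normalized (q.symm g) n hn, ?_⟩
    rw [← map_inv (MulAction.toPermHom Γ Γ), ← map_inv (MulAction.toPermHom Δ Δ)]
    ext x
    change q (q.symm g * n ((q.symm g)⁻¹ * q.symm x)) = g * q (n (q.symm (g⁻¹ * x)))
    simp

theorem transport_symm_transport (q : Γ ≃* Δ) (N : RegularNormalizedSubgroup Γ) :
    (N.transport q).transport q.symm = N := by
  apply ext'
  change (N.toSubgroup.map _).map _ = _
  rw [Subgroup.map_map]
  convert Subgroup.map_id N.toSubgroup
  ext n x
  change q.symm (q (n (q.symm (q x)))) = n x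
  simp

/-- Transport of regular subgroups along an isomorphism of groups, as a bijection. -/
def transportEquiv (q : Γ ≃* Δ) : RegularNormalizedSubgroup Γ ≃ RegularNormalizedSubgroup Δ where
  toFun := transport q
  invFun := transport q.symm
  left_inv := transport_symm_transport q
  right_inv := transport_symm_transport q.symm

variable {N : RegularNormalizedSubgroup Γ} {N' : RegularNormalizedSubgroup Δ} (q : Γ ≃* Δ)
  (hq : N'.toSubgroup = N.toSubgroup.map q.toEquiv.permCongrHom.toMonoidHom)

/-- The isomorphism of a regular subgroup with its transport. -/
def transportIso : N.toSubgroup ≃* N'.toSubgroup :=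
  (N.toSubgroup.equivMapOfInjective _ q.toEquiv.permCongrHom.injective).trans
    (MulEquiv.subgroupCongr hq.symm)

theorem coe_transportIso (n : N.toSubgroup) :
    (transportIso q hq n : Equiv.Perm Δ) = q.toEquiv.permCongr n := rfl

theorem transportIso_inv_apply (n : N.toSubgroup) (x : Γ) :
    (transportIso q hq n : Equiv.Perm Δ)⁻¹ (q x) = q ((n : Equiv.Perm Γ)⁻¹ x) := by
  rw [← Subgroup.coe_inv, ← map_inv, coe_transportIso]
  change q (((n⁻¹ : N.toSubgroup) : Equiv.Perm Γ) (q.symm (q x))) = _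
  rw [MulEquiv.symm_apply_apply]
  rfl

theorem transportIso_conj (g : Γ) (n : N.toSubgroup) :
    transportIso q hq (N.conj g n) = N'.conj (q g) (transportIso q hq n) := by
  apply Subtype.ext
  ext x
  rw [conj_apply_apply, coe_transportIso, coe_transportIso]
  change q ((N.conj g n : Equiv.Perm Γ) (q.symm x)) =
    q g * q ((n : Equiv.Perm Γ) (q.symm ((q g)⁻¹ * x)))
  simp

variable {F L : Type v} [Field F] [Field L] [Algebra F L]

/-- The inclusion `F[N] → L[N']`. -/
def incl : MonoidAlgebra F N.toSubgroup →+* MonoidAlgebra L N'.toSubgroup :=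
  (MonoidAlgebra.mapDomainRingHom L (transportIso q hq : N.toSubgroup →* N'.toSubgroup)).comp
    (MonoidAlgebra.mapRingHom N.toSubgroup (algebraMap F L))

@[simp]
theorem incl_single (n : N.toSubgroup) (c : F) :
    incl (L := L) q hq (MonoidAlgebra.single n c) =
      MonoidAlgebra.single (transportIso q hq n) (algebraMap F L c) := by
  simp [incl]

theorem coeff_incl (z : MonoidAlgebra F N.toSubgroup) (n : N.toSubgroup) :
    (incl (L := L) q hq z).coeff (transportIso q hq n) = algebraMap F L (z.coeff n) := by
  classical
  induction z using MonoidAlgebra.induction_linear with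
  | zero => simp
  | add x y hx hy => simp [hx, hy]
  | single m c =>
    simp only [incl_single, MonoidAlgebra.coeff_single, Finsupp.single_apply,
      (transportIso q hq).injective.eq_iff]
    split_ifs <;> simp

theorem incl_injective : Function.Injective (incl (F := F) (L := L) q hq) := fun x y h => by
  ext n
  apply (algebraMap F L).injective
  rw [← coeff_incl q hq, h, coeff_incl]

theorem incl_smul (c : F) (z : MonoidAlgebra F N.toSubgroup) :
    incl (L := L) q hq (c • z) = algebraMap F L c • incl q hq z := by
  induction z using MonoidAlgebra.induction_linear with
  | zero => simp
  | add x y hx hy => simp only [smul_add, map_add, hx, hy]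
  | single n d => simp [Algebra.smul_def]

/-- The inclusion `F[N] → L[N']` as a semilinear map. -/
def inclₛₗ : MonoidAlgebra F N.toSubgroup →ₛₗ[algebraMap F L] MonoidAlgebra L N'.toSubgroup where
  toFun := incl q hq
  map_add' := map_add _
  map_smul' := incl_smul q hq

theorem comul_incl (z : MonoidAlgebra F N.toSubgroup) :
    Coalgebra.comul (R := L) (incl (L := L) q hq z) =
      TensorProduct.map (inclₛₗ q hq) (inclₛₗ q hq) (Coalgebra.comul (R := F) z) := by
  induction z using MonoidAlgebra.induction_linear with
  | zero => simp
  | add x y hx hy => simp [hx, hy]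
  | single n c => simp [inclₛₗ]

theorem act_incl {σ : F →+* F} {τ : L →+* L}
    (hστ : ∀ x, τ (algebraMap F L x) = algebraMap F L (σ x)) (g : Γ)
    (z : MonoidAlgebra F N.toSubgroup) :
    N'.act τ (q g) (incl q hq z) = incl q hq (N.act σ g z) := by
  induction z using MonoidAlgebra.induction_linear with
  | zero => simp
  | add x y hx hy => simp only [map_add, hx, hy]
  | single n c => simp [hστ, transportIso_conj]

theorem isBaseChange_inclₛₗ (f : MonoidAlgebra F N.toSubgroup →ₗ[F] MonoidAlgebra L N'.toSubgroup)
    (hf : ∀ z, f z = incl q hq z) : IsBaseChange L f := by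
  let b := (MonoidAlgebra.basis N.toSubgroup F).baseChange L
  let b' := MonoidAlgebra.basis N'.toSubgroup L
  refine IsBaseChange.of_equiv (b.equiv b' (transportIso q hq).toEquiv) fun z => ?_
  rw [hf]
  induction z using MonoidAlgebra.induction_linear with
  | zero => simp
  | add x y hx hy => simp only [TensorProduct.tmul_add, map_add, hx, hy]
  | single n c =>
    have h : (1 : L) ⊗ₜ[F] MonoidAlgebra.single n c = algebraMap F L c • b n := by
      rw [Module.Basis.baseChange_apply, MonoidAlgebra.basis_apply, algebraMap_smul,
        ← TensorProduct.tmul_smul]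
      simp
    rw [h, map_smul, Module.Basis.equiv_apply, MonoidAlgebra.basis_apply]
    simp [Algebra.smul_def]

end RegularNormalizedSubgroup

/-- Evaluation is injective on `M[N]`, so the action forces the identification. A statement about
all identifications thus reduces to a chosen one. -/
instance {k : Type u} {M : Type v} [Field k] [Field M] [Algebra k M] [FiniteDimensional k M]
    [IsGalois k M] {Γ : Type v} [Group Γ] (φ : Γ ≃* (M ≃ₐ[k] M)) (S : HopfGaloisStructure k M)
    (N : RegularNormalizedSubgroup Γ) : Subsingleton (GreitherPareigisIso φ S N) where
  allEq ψ χ := by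
    have h : ψ.toAlgEquiv = χ.toAlgEquiv := by
      ext1 h
      apply Subtype.ext
      apply (N.evalEquiv φ).injective
      rw [N.evalEquiv_apply, N.evalEquiv_apply, ← ψ.action_eq_evalAt, ← χ.action_eq_evalAt]
    cases ψ; cases χ; cases h; rfl

/-! ### Comparison of `E ⊗ H̄` with `H₂`. -/

section BaseChangeTower

variable {R S T M A B : Type*} [CommSemiring R] [CommSemiring S] [CommSemiring T] [Algebra R S]
  [Algebra R T] [Algebra S T] [IsScalarTower R S T] [AddCommMonoid M] [Module R M]
  [AddCommMonoid A] [Module R A] [Module S A] [IsScalarTower R S A]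
  [AddCommMonoid B] [Module R B] [Module S B] [Module T B] [IsScalarTower R S B]
  [IsScalarTower R T B] [IsScalarTower S T B]

theorem IsBaseChange.of_eq_comp {f : M →ₗ[R] A} (hf : IsBaseChange S f) {g : A →ₗ[S] B}
    (hg : IsBaseChange T g) {h : M →ₗ[R] B} (hh : ∀ x, h x = g (f x)) : IsBaseChange T h := by
  have : h = g.restrictScalars R ∘ₗ f := LinearMap.ext hh
  rw [this]
  exact hf.comp hg

theorem IsBaseChange.of_comp_eq {f : M →ₗ[R] A} (hf : IsBaseChange S f) {h : M →ₗ[R] B}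
    (hh : IsBaseChange T h) {g : A →ₗ[S] B} (hg : ∀ x, g (f x) = h x) : IsBaseChange T g := by
  have : h = g.restrictScalars R ∘ₗ f := LinearMap.ext fun x => (hg x).symm
  rw [this] at hh
  exact IsBaseChange.of_comp hf hh

end BaseChangeTower

theorem IsBaseChange.of_eq_comp_algEquiv {k M H H' B : Type*} [CommSemiring k] [CommSemiring M]
    [Algebra k M] [Semiring H] [Algebra k H] [Semiring H'] [Algebra k H'] [Semiring B]
    [Algebra k B] [Algebra M B] [IsScalarTower k M B] {f : H' →ₐ[k] B}
    (hf : IsBaseChange M f.toLinearMap) (e : H ≃ₐ[k] H') {g : H →ₐ[k] B}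
    (hg : ∀ x, g x = f (e x)) : IsBaseChange M g.toLinearMap := by
  have : g.toLinearMap = f.toLinearMap ∘ₗ e.toLinearEquiv.toLinearMap := LinearMap.ext hg
  rw [this]
  exact IsBaseChange.comp_equiv e.toLinearEquiv _ hf

/-- The two routes from `X ⊗[K] X` to `B ⊗[L] B`, through `E` and through `F`, agree. This carries
the comultiplication of `H̄` to that of `H₂`. -/
theorem tensorOver_map_tensorOver {K F E L X Y A B : Type*} [Field K] [Field F] [Field E] [Field L]
    [Algebra K F] [Algebra K E] [Algebra F L] [Algebra E L]
    [AddCommGroup X] [Module K X] [AddCommGroup Y] [Module E Y]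
    [AddCommGroup A] [Module K A] [Module F A] [IsScalarTower K F A]
    [AddCommGroup B] [Module E B] [Module L B] [IsScalarTower E L B]
    (f : X →ₗ[K] A) (i : A →ₛₗ[algebraMap F L] B) (g : Y →ₗ[E] B) (e : E ⊗[K] X →ₗ[E] Y)
    (h : ∀ x, g (e (1 ⊗ₜ[K] x)) = i (f x)) (w : X ⊗[K] X) :
    tensorOver L g g (TensorProduct.map e e
      (tensorOver E (TensorProduct.mk K E X 1) (TensorProduct.mk K E X 1) w)) =
      TensorProduct.map i i (tensorOver F f f w) := by
  induction w with
  | zero => simp only [map_zero]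
  | add a b ha hb => simp only [map_add, ha, hb]
  | tmul a b => simp [h]

namespace GreitherPareigisIso

open RegularNormalizedSubgroup

/-- The embedding `H ≅ M[N]^Γ ⊆ M[N]`. -/
def toMonoidAlgebra {k : Type u} {M Γ : Type v} [Field k] [Field M] [Algebra k M] [Group Γ]
    {φ : Γ ≃* (M ≃ₐ[k] M)} {S : HopfGaloisStructure k M} {N : RegularNormalizedSubgroup Γ}
    (ψ : GreitherPareigisIso φ S N) : S.carrier →ₐ[k] MonoidAlgebra M N.toSubgroup :=
  (N.fixedPoints φ).val.comp ψ.toAlgEquiv.toAlgHom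

theorem isBaseChange_toMonoidAlgebra {k : Type u} {M Γ : Type v} [Field k] [Field M] [Algebra k M]
    [FiniteDimensional k M] [IsGalois k M] [Group Γ] {φ : Γ ≃* (M ≃ₐ[k] M)}
    {S : HopfGaloisStructure k M} {N : RegularNormalizedSubgroup Γ}
    (ψ : GreitherPareigisIso φ S N) : IsBaseChange M ψ.toMonoidAlgebra.toLinearMap :=
  (N.isBaseChange_fixedPoints φ).of_eq_comp_algEquiv ψ.toAlgEquiv fun _ => rfl

theorem tensorOver_injective {k : Type u} {M Γ : Type v} [Field k] [Field M] [Algebra k M]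
    [FiniteDimensional k M] [IsGalois k M] [Group Γ] {φ : Γ ≃* (M ≃ₐ[k] M)}
    {S : HopfGaloisStructure k M} {N : RegularNormalizedSubgroup Γ}
    (ψ : GreitherPareigisIso φ S N) : Function.Injective
      (tensorOver M ψ.toMonoidAlgebra.toLinearMap ψ.toMonoidAlgebra.toLinearMap) :=
  (ψ.isBaseChange_toMonoidAlgebra.tensorOver ψ.isBaseChange_toMonoidAlgebra).injective_of_field

theorem comul_toMonoidAlgebra {k : Type u} {M Γ : Type v} [Field k] [Field M] [Algebra k M]
    [Group Γ] {φ : Γ ≃* (M ≃ₐ[k] M)}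
    {S : HopfGaloisStructure k M} {N : RegularNormalizedSubgroup Γ}
    (ψ : GreitherPareigisIso φ S N) (h : S.carrier) :
    Coalgebra.comul (R := M) (ψ.toMonoidAlgebra h) =
      tensorOver M ψ.toMonoidAlgebra.toLinearMap ψ.toMonoidAlgebra.toLinearMap
        (Coalgebra.comul (R := k) h) :=
  ψ.comul_eq h

variable {K : Type u} {F E L : Type v} [Field K] [Field F] [Field E] [Field L]
  [Algebra K F] [Algebra K E] [Algebra K L] [Algebra F L] [Algebra E L]
  [IsScalarTower K F L] [IsScalarTower K E L]
  [FiniteDimensional K F] [IsGalois K F] [FiniteDimensional E L] [IsGalois E L]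
  {Γ Δ : Type v} [Group Γ] [Group Δ] {φ : Γ ≃* (F ≃ₐ[K] F)} {χ : Δ ≃* (L ≃ₐ[E] L)}
  {S : HopfGaloisStructure K F} {T : HopfGaloisStructure E L}
  {N : RegularNormalizedSubgroup Γ} {N' : RegularNormalizedSubgroup Δ}
  (ψS : GreitherPareigisIso φ S N) (ψT : GreitherPareigisIso χ T N')
  (q : Γ ≃* Δ) (hq : N'.toSubgroup = N.toSubgroup.map q.toEquiv.permCongrHom.toMonoidHom)
  (hφχ : ∀ g x, χ (q g) (algebraMap F L x) = algebraMap F L (φ g x))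

/-- The map `H̄ ≅ F[N]^Γ → L[N']`. -/
def toL : S.carrier →ₐ[K] MonoidAlgebra L N'.toSubgroup where
  toFun h := incl q hq (ψS.toAlgEquiv h : MonoidAlgebra F N.toSubgroup)
  map_one' := by simp
  map_zero' := by simp
  map_mul' a b := by simp
  map_add' a b := by simp
  commutes' r := by
    rw [AlgEquiv.commutes]
    change incl q hq (algebraMap K (MonoidAlgebra F N.toSubgroup) r) = _
    simp [MonoidAlgebra.coe_algebraMap, ← IsScalarTower.algebraMap_apply]

theorem toL_apply (h : S.carrier) :
    ψS.toL (L := L) q hq h = incl q hq (ψS.toAlgEquiv h : MonoidAlgebra F N.toSubgroup) := rfl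

/-- The inclusion `F[N] → L[N']` as an `F`-algebra homomorphism. -/
def inclAlgHom : MonoidAlgebra F N.toSubgroup →ₐ[F] MonoidAlgebra L N'.toSubgroup :=
  { incl (L := L) q hq with
    commutes' := fun r => by
      change incl q hq (algebraMap F (MonoidAlgebra F N.toSubgroup) r) = _
      simp [MonoidAlgebra.coe_algebraMap] }

theorem isBaseChange_inclAlgHom :
    IsBaseChange L (inclAlgHom (F := F) (L := L) q hq).toLinearMap :=
  isBaseChange_inclₛₗ q hq _ fun _ => rfl

theorem isBaseChange_toL : IsBaseChange L (ψS.toL (L := L) q hq).toLinearMap :=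
  ψS.isBaseChange_toMonoidAlgebra.of_eq_comp (isBaseChange_inclAlgHom (L := L) q hq)
    fun h => rfl

variable (E) in
/-- The map `E ⊗ H̄ → L[N']`. -/
def tensorToL : E ⊗[K] S.carrier →ₐ[E] MonoidAlgebra L N'.toSubgroup :=
  Algebra.TensorProduct.lift (Algebra.ofId E _) (ψS.toL q hq) fun a _ => Algebra.commutes a _

theorem tensorToL_tmul (a : E) (h : S.carrier) :
    ψS.tensorToL E (L := L) q hq (a ⊗ₜ[K] h) = a • ψS.toL q hq h :=
  (Algebra.smul_def a (ψS.toL (L := L) q hq h)).symm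

/-- Two-out-of-three for base change in the tower `K ⊆ E ⊆ L`, given that `H̄` is a `K`-form of
`L[N']` by way of `F`. -/
theorem isBaseChange_tensorToL : IsBaseChange L (ψS.tensorToL E (L := L) q hq).toLinearMap :=
  IsBaseChange.of_comp_eq (TensorProduct.isBaseChange K S.carrier E)
    (ψS.isBaseChange_toL (L := L) q hq) fun h =>
      (ψS.tensorToL_tmul q hq 1 h).trans (one_smul E _)

include hφχ

theorem act_toL (g : Δ) (h : S.carrier) :
    N'.act (χ g : L →+* L) g (ψS.toL q hq h) = ψS.toL q hq h := by
  obtain ⟨g, rfl⟩ := q.surjective g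
  rw [toL_apply, act_incl q hq (σ := (φ g : F →+* F)) (hφχ g), (ψS.toAlgEquiv h).2 g]

theorem act_tensorToL (g : Δ) (z : E ⊗[K] S.carrier) :
    N'.act (χ g : L →+* L) g (ψS.tensorToL E q hq z) = ψS.tensorToL E q hq z := by
  induction z with
  | zero => simp
  | add a b ha hb => simp only [map_add, ha, hb]
  | tmul a h =>
    rw [tensorToL_tmul, ← algebraMap_smul L a, act_smul, act_toL ψS q hq hφχ]
    congr 1
    exact (χ g).commutes a

/-- `E ⊗ H̄ ≅ L[N']^Δ`. -/
def tensorEquivFixedPoints : E ⊗[K] S.carrier ≃ₐ[E] N'.fixedPoints χ :=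
  AlgEquiv.ofBijective
    ((ψS.tensorToL E q hq).codRestrict (N'.fixedPoints χ)
      fun z g => ψS.act_tensorToL q hq hφχ g z)
    ⟨fun a b h => (ψS.isBaseChange_tensorToL q hq).injective_of_field (congrArg Subtype.val h),
    fun z => by
      -- Surjectivity is descent for `L/E`: the form `E ⊗ H̄` consists of fixed elements, so it
      -- contains every fixed element.
      obtain ⟨w, hw⟩ := (ψS.isBaseChange_tensorToL (E := E) q hq).mem_range_of_fixed χ
        (fun g => (N'.act (χ g : L →+* L) g :
          MonoidAlgebra L N'.toSubgroup →+ MonoidAlgebra L N'.toSubgroup))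
        (fun g m v => N'.act_smul _ g m v)
        (fun g z => ψS.act_tensorToL q hq hφχ g z) (v := z.1) z.2
      exact ⟨w, Subtype.ext hw⟩⟩

/-- `E ⊗ H̄ ≅ H₂` as algebras. -/
def tensorAlgEquiv : E ⊗[K] S.carrier ≃ₐ[E] T.carrier :=
  (ψS.tensorEquivFixedPoints q hq hφχ).trans ψT.toAlgEquiv.symm

theorem coe_toAlgEquiv_tensorAlgEquiv (z : E ⊗[K] S.carrier) :
    (ψT.toAlgEquiv (tensorAlgEquiv ψS ψT q hq hφχ z) : MonoidAlgebra L N'.toSubgroup) =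
      ψS.tensorToL E q hq z := by
  rw [tensorAlgEquiv, AlgEquiv.trans_apply, AlgEquiv.apply_symm_apply]
  rfl

theorem evalAt_incl (z : MonoidAlgebra F N.toSubgroup) (y : E) (x : F) :
    N'.evalAt χ 1 (incl q hq z) (algebraMap E L y * algebraMap F L x) =
      algebraMap E L y * algebraMap F L (N.evalAt φ 1 z x) := by
  induction z using MonoidAlgebra.induction_linear with
  | zero => simp
  | add a b ha hb => simp only [map_add, LinearMap.add_apply, ha, hb, mul_add]
  | single n c =>
    have h := transportIso_inv_apply q hq n 1
    rw [map_one] at h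
    rw [incl_single, evalAt_single, evalAt_single, h]
    simp only [LinearMap.smul_apply, AlgEquiv.toLinearMap_apply, map_mul, AlgEquiv.commutes, hφχ,
      smul_eq_mul]
    ring

theorem action_tensorAlgEquiv (a : E) (h : S.carrier) (y : E) (x : F) :
    T.action (tensorAlgEquiv ψS ψT q hq hφχ (a ⊗ₜ[K] h)) (algebraMap E L y * algebraMap F L x) =
      algebraMap E L a * algebraMap E L y * algebraMap F L (S.action h x) := by
  rw [ψT.action_eq_evalAt, coe_toAlgEquiv_tensorAlgEquiv, tensorToL_tmul, ← algebraMap_smul L a,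
    map_smul, LinearMap.smul_apply, toL_apply, evalAt_incl q hq hφχ, ψS.action_eq_evalAt,
    smul_eq_mul, mul_assoc]

/-- The counit is read off from the action on `1`. -/
theorem counit_tensorAlgEquiv (z : E ⊗[K] S.carrier) :
    Coalgebra.counit (R := E) (tensorAlgEquiv ψS ψT q hq hφχ z) =
      Coalgebra.counit (R := E) z := by
  induction z with
  | zero => simp
  | add a b ha hb => simp only [map_add, ha, hb]
  | tmul a h =>
    apply (algebraMap E L).injective
    have h1 := action_tensorAlgEquiv ψS ψT q hq hφχ a h 1 1
    rw [map_one, map_one, mul_one, mul_one] at h1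
    rw [← T.action_one, h1, S.action_one, TensorProduct.counit_tmul, Algebra.smul_def, map_mul,
      ← IsScalarTower.algebraMap_apply, ← IsScalarTower.algebraMap_apply, mul_comm]
    rfl

theorem coe_toAlgEquiv_tensorAlgEquiv_one_tmul (h : S.carrier) :
    (ψT.toAlgEquiv (tensorAlgEquiv ψS ψT q hq hφχ (1 ⊗ₜ[K] h)) : MonoidAlgebra L N'.toSubgroup) =
      incl q hq (ψS.toAlgEquiv h : MonoidAlgebra F N.toSubgroup) := by
  rw [coe_toAlgEquiv_tensorAlgEquiv, tensorToL_tmul, one_smul, toL_apply]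

theorem map_comul_tensorAlgEquiv (z : E ⊗[K] S.carrier) :
    TensorProduct.map (tensorAlgEquiv ψS ψT q hq hφχ).toLinearMap
      (tensorAlgEquiv ψS ψT q hq hφχ).toLinearMap (Coalgebra.comul (R := E) z) =
      Coalgebra.comul (R := E) (tensorAlgEquiv ψS ψT q hq hφχ z) := by
  induction z with
  | zero => simp
  | add a b ha hb => simp only [map_add, ha, hb]
  | tmul a h =>
    have ha : a ⊗ₜ[K] h = a • ((1 : E) ⊗ₜ[K] h) := by simp [TensorProduct.smul_tmul']
    rw [ha, map_smul, map_smul, map_smul, map_smul]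
    congr 1
    -- Inside `L[N'] ⊗[L] L[N']` both sides are the comultiplication of the same element of `F[N] ⊆
    -- L[N']`.
    apply ψT.tensorOver_injective
    have h1 := tensorOver_map_tensorOver (F := F) (L := L)
      ψS.toMonoidAlgebra.toLinearMap (inclₛₗ q hq)
      ψT.toMonoidAlgebra.toLinearMap
      (tensorAlgEquiv ψS ψT q hq hφχ).toLinearMap
      (fun h => coe_toAlgEquiv_tensorAlgEquiv_one_tmul ψS ψT q hq hφχ h)
      (Coalgebra.comul (R := K) h)
    have h2 := (congrArg (Coalgebra.comul (R := L))
      (coe_toAlgEquiv_tensorAlgEquiv_one_tmul ψS ψT q hq hφχ h)).trans (comul_incl q hq _)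
    have h3 := congrArg (TensorProduct.map (inclₛₗ (L := L) q hq) (inclₛₗ q hq)) (ψS.comul_toMonoidAlgebra h)
    rw [TensorProduct.comul_one_tmul']
    exact h1.trans (h3.symm.trans (h2.symm.trans (ψT.comul_toMonoidAlgebra _)))

/-- `E ⊗ H̄ ≅ H₂` as Hopf algebras. -/
def tensorBialgEquiv : E ⊗[K] S.carrier ≃ₐc[E] T.carrier :=
  BialgEquiv.ofAlgEquiv (tensorAlgEquiv ψS ψT q hq hφχ)
    (AlgHom.ext (counit_tensorAlgEquiv ψS ψT q hq hφχ))
    (AlgHom.ext (map_comul_tensorAlgEquiv ψS ψT q hq hφχ))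

theorem coe_toAlgEquiv_tensorBialgEquiv_one_tmul (h : S.carrier) :
    (ψT.toAlgEquiv (tensorBialgEquiv ψS ψT q hq hφχ (1 ⊗ₜ[K] h)) :
      MonoidAlgebra L N'.toSubgroup) =
      incl q hq (ψS.toAlgEquiv h : MonoidAlgebra F N.toSubgroup) :=
  coe_toAlgEquiv_tensorAlgEquiv_one_tmul ψS ψT q hq hφχ h

theorem coeff_tensorBialgEquiv (h : S.carrier) (n : N.toSubgroup) (n' : N'.toSubgroup)
    (hn : (n' : Equiv.Perm Δ) = q.toEquiv.permCongr n) :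
    (ψT.toAlgEquiv (tensorBialgEquiv ψS ψT q hq hφχ (1 ⊗ₜ[K] h)) :
        MonoidAlgebra L N'.toSubgroup).coeff n' =
      algebraMap F L ((ψS.toAlgEquiv h : MonoidAlgebra F N.toSubgroup).coeff n) := by
  have hn' : n' = transportIso q hq n := Subtype.ext hn
  rw [hn', ← coeff_incl q hq, coe_toAlgEquiv_tensorBialgEquiv_one_tmul]

/-- Only the fixed field of `J` matters: invariance forces all coefficients into `F`, and the
resulting element of `F[N]` is `Γ`-fixed because the inclusion into `L[N']` is equivariant and
injective. -/
theorem range_tensorBialgEquiv {J : Set (L →+* L)}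
    (hJ : ∀ c : L, c ∈ (algebraMap F L).range ↔ ∀ σ ∈ J, σ c = c) :
    Set.range (fun h : S.carrier => tensorBialgEquiv ψS ψT q hq hφχ (1 ⊗ₜ[K] h)) =
      {t : T.carrier | ∀ σ ∈ J,
        N'.act σ 1 (ψT.toAlgEquiv t : MonoidAlgebra L N'.toSubgroup) =
          (ψT.toAlgEquiv t : MonoidAlgebra L N'.toSubgroup)} := by
  have hcoeff : ∀ (σ : L →+* L) (z : MonoidAlgebra L N'.toSubgroup) n,
      (N'.act σ 1 z).coeff n = σ (z.coeff n) := fun σ z n => by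
    have h := N'.coeff_act σ 1 z n
    rwa [conj_one] at h
  ext t
  constructor
  · rintro ⟨h, rfl⟩ σ hσ
    rw [coe_toAlgEquiv_tensorBialgEquiv_one_tmul]
    ext n'
    obtain ⟨n, rfl⟩ := (transportIso q hq).surjective n'
    rw [hcoeff, coeff_incl]
    exact (hJ _).mp ⟨_, rfl⟩ σ hσ
  · intro ht
    have hmem : ∀ n : N.toSubgroup, ∃ c : F, algebraMap F L c =
        (ψT.toAlgEquiv t : MonoidAlgebra L N'.toSubgroup).coeff (transportIso q hq n) := by
      intro n
      refine (hJ _).mpr fun σ hσ => ?_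
      rw [← hcoeff, ht σ hσ]
    choose c hc using hmem
    have := finite_of_mulEquiv_gal φ
    have : Finite N.toSubgroup := Finite.of_equiv _ N.pointEquiv.symm
    let z : MonoidAlgebra F N.toSubgroup := MonoidAlgebra.ofCoeff (Finsupp.equivFunOnFinite.symm c)
    have hz : incl q hq z = (ψT.toAlgEquiv t : MonoidAlgebra L N'.toSubgroup) := by
      ext n'
      obtain ⟨n, rfl⟩ := (transportIso q hq).surjective n'
      rw [coeff_incl]
      exact hc n
    have hfix : z ∈ N.fixedPoints φ := by
      intro g
      apply incl_injective (L := L) q hq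
      rw [← act_incl q hq (τ := (χ (q g) : L →+* L)) (hφχ g), hz, (ψT.toAlgEquiv t).2 (q g)]
    refine ⟨ψS.toAlgEquiv.symm ⟨z, hfix⟩, ?_⟩
    apply ψT.toAlgEquiv.injective
    apply Subtype.ext
    dsimp only
    rw [coe_toAlgEquiv_tensorBialgEquiv_one_tmul, AlgEquiv.apply_symm_apply, hz]

end GreitherPareigisIso

end

/-! ### The proposition. -/

theorem proposition5p2 {K L : Type*} [Field K] [Field L] [Algebra K L]
    [FiniteDimensional K L] [IsGalois K L]
    (J G' : Subgroup (L ≃ₐ[K] L)) [J.Normal] (hG : Subgroup.IsComplement' J G') :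
    ∃ (Φ : HopfGaloisClass K (IntermediateField.fixedField J) ≃
          HopfGaloisClass (IntermediateField.fixedField G') L)
      (gpF : HopfGaloisClass K (IntermediateField.fixedField J) ≃
          RegularNormalizedSubgroup ((L ≃ₐ[K] L) ⧸ J))
      (gpL : HopfGaloisClass (IntermediateField.fixedField G') L ≃
          RegularNormalizedSubgroup G'),
      -- `gpF` and `gpL` are the Greither-Pareigis bijections of `F / K` and `L / E`
      (∀ (S : HopfGaloisStructure K (IntermediateField.fixedField J))
          (N : RegularNormalizedSubgroup ((L ≃ₐ[K] L) ⧸ J)),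
        gpF S.cls = N ↔
          Nonempty (GreitherPareigisIso (IsGalois.normalAutEquivQuotient J) S N)) ∧
      (∀ (T : HopfGaloisStructure (IntermediateField.fixedField G') L)
          (N' : RegularNormalizedSubgroup G'),
        gpL T.cls = N' ↔
          Nonempty (GreitherPareigisIso (IntermediateField.subgroupEquivAlgEquiv G') T N')) ∧
      -- `Φ` is given by the identification `G / J ≅ G'`
      (∀ c : HopfGaloisClass K (IntermediateField.fixedField J),
        (gpL (Φ c)).toSubgroup =
          (gpF c).toSubgroup.map
            (hG.symm.QuotientMulEquiv.toEquiv.permCongrHom).toMonoidHom) ∧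
      -- `H₂ = E ⊗ H̄` and `H̄ = H₂ ^ J`
      (∀ (S : HopfGaloisStructure K (IntermediateField.fixedField J))
          (T : HopfGaloisStructure (IntermediateField.fixedField G') L),
        Φ S.cls = T.cls →
        ∃ e : ((IntermediateField.fixedField G') ⊗[K] S.carrier)
            ≃ₐc[IntermediateField.fixedField G'] T.carrier,
          (∀ (a : IntermediateField.fixedField G') (h : S.carrier)
              (y : IntermediateField.fixedField G') (x : IntermediateField.fixedField J),
            T.action (e (a ⊗ₜ[K] h)) ((y : L) * (x : L)) =
              (a : L) * (y : L) * (S.action h x : L)) ∧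
          ∀ (ψS : GreitherPareigisIso (IsGalois.normalAutEquivQuotient J) S (gpF S.cls))
            (ψT : GreitherPareigisIso (IntermediateField.subgroupEquivAlgEquiv G') T
              (gpL T.cls)),
            -- inside `L[N₂]`, the map `h ↦ e (1 ⊗ h)` is the inclusion `F[N₂] ⊆ L[N₂]`
            (∀ (h : S.carrier) (n : (gpF S.cls).toSubgroup) (n' : (gpL T.cls).toSubgroup),
              (n' : Equiv.Perm G') = hG.symm.QuotientMulEquiv.toEquiv.permCongr n →
              (ψT.toAlgEquiv (e (1 ⊗ₜ[K] h)) :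
                  MonoidAlgebra L (gpL T.cls).toSubgroup).coeff n' =
                ((ψS.toAlgEquiv h : MonoidAlgebra (IntermediateField.fixedField J)
                  (gpF S.cls).toSubgroup).coeff n : L)) ∧
            -- its image is the set of elements of `H₂` fixed by `J`
            Set.range (fun h : S.carrier => e (1 ⊗ₜ[K] h)) =
              {t : T.carrier | ∀ σ ∈ J,
                (gpL T.cls).act (σ : L →+* L)
                  (hG.symm.QuotientMulEquiv (QuotientGroup.mk σ))
                  (ψT.toAlgEquiv t : MonoidAlgebra L (gpL T.cls).toSubgroup) =
                  (ψT.toAlgEquiv t : MonoidAlgebra L (gpL T.cls).toSubgroup)}) := by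
  let q := hG.symm.QuotientMulEquiv
  let φ := IsGalois.normalAutEquivQuotient J
  let χ := IntermediateField.subgroupEquivAlgEquiv G'
  have hφχ : ∀ (g : (L ≃ₐ[K] L) ⧸ J) (x : IntermediateField.fixedField J),
      χ (q g) (algebraMap _ L x) = algebraMap _ L (φ g x) := by
    intro g x
    -- Each class in `G/J` is represented by some `τ ∈ G'`, and the class acts on `F` as the
    -- restriction of `τ`.
    obtain ⟨τ, rfl⟩ := q.symm.surjective g
    rw [MulEquiv.apply_symm_apply]
    exact (AlgEquiv.restrictNormal_commutes (τ : L ≃ₐ[K] L) (IntermediateField.fixedField J) x).symm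
  refine ⟨((greitherPareigisEquiv φ).trans
      (RegularNormalizedSubgroup.transportEquiv q)).trans (greitherPareigisEquiv χ).symm,
    greitherPareigisEquiv φ, greitherPareigisEquiv χ, greitherPareigisEquiv_cls φ,
    greitherPareigisEquiv_cls χ, fun c => ?_, fun S T hST => ?_⟩
  · simp only [Equiv.trans_apply, Equiv.apply_symm_apply]
    rfl
  · have hq : (greitherPareigisEquiv χ T.cls).toSubgroup =
        (greitherPareigisEquiv φ S.cls).toSubgroup.map
          q.toEquiv.permCongrHom.toMonoidHom := by
      rw [← hST]
      simp only [Equiv.trans_apply, Equiv.apply_symm_apply]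
      rfl
    obtain ⟨ψ⟩ := (greitherPareigisEquiv_cls φ S _).mp rfl
    obtain ⟨ψ'⟩ := (greitherPareigisEquiv_cls χ T _).mp rfl
    refine ⟨GreitherPareigisIso.tensorBialgEquiv ψ ψ' q hq hφχ,
      fun a h y x => GreitherPareigisIso.action_tensorAlgEquiv ψ ψ' q hq hφχ a h y x,
      fun ψS ψT => ?_⟩
    obtain rfl := Subsingleton.elim ψS ψ
    obtain rfl := Subsingleton.elim ψT ψ'
    refine ⟨fun h n n' hn =>
      GreitherPareigisIso.coeff_tensorBialgEquiv ψS ψT q hq hφχ h n n' hn, ?_⟩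
    rw [GreitherPareigisIso.range_tensorBialgEquiv ψS ψT q hq hφχ
      (J := {τ | ∃ σ ∈ J, τ = (σ : L →+* L)})]
    · ext t
      -- The class of `σ ∈ J` is trivial, so `J` acts on the coefficients only.
      have h1 : ∀ σ ∈ J, q (QuotientGroup.mk σ) = 1 := fun σ hσ => by
        rw [(QuotientGroup.eq_one_iff σ).mpr hσ, map_one]
      constructor
      · intro ht σ hσ
        have := ht _ ⟨σ, hσ, rfl⟩
        rw [← h1 σ hσ] at this
        exact this
      · rintro ht _ ⟨σ, hσ, rfl⟩
        have := ht σ hσ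
        rw [show hG.symm.QuotientMulEquiv (QuotientGroup.mk σ) = 1 from h1 σ hσ] at this
        exact this
    · intro c
      constructor
      · rintro ⟨x, rfl⟩ _ ⟨σ, hσ, rfl⟩
        exact x.2 ⟨σ, hσ⟩
      · intro h
        exact ⟨⟨c, fun σ => h _ ⟨σ.1, σ.2, rfl⟩⟩, rfl⟩
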